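/- Let $\mathcal X,\mathcal Y$ be finite alphabets with $|\mathcal X|\ge 2$, let $P_{XY}$ be a probability distribution on $\mathcal X\times\mathcal Y$, let $a(\cdot)$ be a real-valued continuous function on the simplex of probability distributions on $\mathcal X\times\mathcal Y$, and let $R_w,R_s\ge 0$. All logarithms are natural. For a block length $n$, let $\mathcal W_n=\{0,1,\dots,\lfloor e^{nR_w}\rfloor\}$ and $\mathcal S_n=\{0,1,\dots,\lfloor e^{nR_s}\rfloor\}$. In the random-binning ensemble of enrollment encoders $(f,g)$, every $\boldsymbol x\in\mathcal X^n$ gets a helper message $f(\boldsymbol x)$, uniform on $\mathcal W_n$, and a secret key $g(\boldsymbol x)$, uniform on $\mathcal S_n$, and all these $2|\mathcal X|^n$ random variables are mutually independent. The pair $(\boldsymbol X,\boldsymbol Y)$ consists of $n$ independent copies of $(X,Y)\sim P_{XY}$ and is independent of $(f,g)$; put $\boldsymbol W=f(\boldsymbol X)$ and $\boldsymbol S=g(\boldsymbol X)$. The generalized stochastic likelihood decoder, which knows $(f,g)$, is given $(\boldsymbol Y,\boldsymbol W)=(\boldsymbol y,\boldsymbol w)$ and draws its estimate $\hat{\boldsymbol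 S}$ of $\boldsymbol S$ from $$\tilde P(\boldsymbol s\mid\boldsymbol y,\boldsymbol w)=\frac{\sum_{\boldsymbol x\in\mathcal X^n:\,f(\boldsymbol x)=\boldsymbol w,\ g(\boldsymbol x)=\boldsymbol s}\exp\{n\,a(\hat P_{\boldsymbol x\boldsymbol y})\}}{\sum_{\boldsymbol x\in\mathcal X^n:\,f(\boldsymbol x)=\boldsymbol w}\exp\{n\,a(\hat P_{\boldsymbol x\boldsymbol y})\}},$$ where $\hat P_{\boldsymbol x\boldsymbol y}$ is the joint empirical distribution of $(\boldsymbol x,\boldsymbol y)$. Let $\bar P_{FR}=\Pr\{\hat{\boldsymbol S}\neq\boldsymbol S\}$ be the false-reject probability at block length $n$, averaged over the ensemble. For a probability distribution $Q_{X_0Y}$ on $\mathcal X\times\mathcal Y$ put $$E(R_w,Q_{X_0Y})=\min_{Q_{X|Y}}\big[R_w-H_Q(X|Y)+[a(Q_{X_0Y})-a(Q_{XY})]_+\big]_+,\qquad E_r^{FR}(R_w)=\min_{Q_{X_0Y}}\{D(Q_{X_0Y}\|P_{XY})+E(R_w,Q_{X_0Y})\},$$ where $[t]_+=\max\{0,t\}$,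 $Q_{X|Y}$ ranges over all conditional distributions, $Q_{XY}=Q_Y\times Q_{X|Y}$ with $Q_Y$ the marginal of $Q_{X_0Y}$, $H_Q(X|Y)$ is the conditional entropy under $Q_{XY}$, $Q_{X_0Y}$ ranges over all probability distributions on $\mathcal X\times\mathcal Y$, and $D(\cdot\|\cdot)$ is the Kullback–Leibler divergence (equal to $+\infty$ in the absence of absolute continuity). Then all these minima are attained, $\bar P_{FR}>0$ for all sufficiently large $n$, and $$\lim_{n\to\infty}\left[-\frac{\ln\bar P_{FR}}{n}\right]=E_r^{FR}(R_w).$$ In particular, the exponent does not depend on $R_s$. -/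

import Mathlib

open Filter Topology

noncomputable section

namespace Biometric

/-- `[t]_+ = max {0, t}`. -/
def posPart (t : ℝ) : ℝ := max 0 t

section SingleLetter

variable {X Y : Type*} [Fintype X] [Fintype Y]

/-- The marginal `Q_Y` of a joint distribution `Q_{XY}`. -/
def marginalY (Q : X × Y → ℝ) (y : Y) : ℝ := ∑ x, Q (x, y)

/-- Conditional entropy `H_Q(X|Y) = - ∑ Q(x,y) ln Q(x|y)` in nats
(terms with `Q(x,y) = 0` vanish). -/
def condEntropy (Q : X × Y → ℝ) : ℝ :=
  -∑ x, ∑ y, Q (x, y) * Real.log (Q (x, y) / marginalY Q y)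

open Classical in
/-- Kullback-Leibler divergence `D(Q‖P)` of two distributions on a finite set, in nats;
it is `⊤` unless the support of `Q` lies in the support of `P`. -/
def divergence {Z : Type*} [Fintype Z] (Q P : Z → ℝ) : EReal :=
  if ∀ z, P z = 0 → Q z = 0 then ((∑ z, Q z * Real.log (Q z / P z) : ℝ) : EReal) else ⊤

/-- The set of all conditional distributions `Q_{X|Y}`: `V y x` is `Q_{X|Y}(x|y)`. -/
def channels (X Y : Type*) [Fintype X] : Set (Y → X → ℝ) :=
  {V | ∀ y, V y ∈ stdSimplex ℝ X}

/-- The joint distribution `Q_Y × Q_{X|Y}`. -/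
def joint (QY : Y → ℝ) (V : Y → X → ℝ) : X × Y → ℝ := fun z => QY z.2 * V z.2 z.1

/-- The values `[R_w - H_Q(X|Y) + [a(Q_{X₀Y}) - a(Q_{XY})]_+]_+` as `Q_{X|Y}` ranges over all
conditional distributions, where `Q_{XY} = Q_Y × Q_{X|Y}` and `Q_Y` is the marginal of
`Q_{X₀Y} = Q₀`. -/
def innerValues (a : (X × Y → ℝ) → ℝ) (Rw : ℝ) (Q₀ : X × Y → ℝ) : Set ℝ :=
  (fun V : Y → X → ℝ =>
    posPart (Rw - condEntropy (joint (marginalY Q₀) V)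
      + posPart (a Q₀ - a (joint (marginalY Q₀) V)))) '' channels X Y

/-- `E(R_w, Q_{X₀Y})`, the minimum of `innerValues`. -/
def innerExponent (a : (X × Y → ℝ) → ℝ) (Rw : ℝ) (Q₀ : X × Y → ℝ) : ℝ :=
  sInf (innerValues a Rw Q₀)

/-- The values `D(Q_{X₀Y}‖P_{XY}) + E(R_w, Q_{X₀Y})` as `Q_{X₀Y}` ranges over all
joint distributions. -/
def outerValues (P : X × Y → ℝ) (a : (X × Y → ℝ) → ℝ) (Rw : ℝ) : Set EReal :=
  (fun Q₀ : X × Y → ℝ => divergence Q₀ P + ((innerExponent a Rw Q₀ : ℝ) : EReal)) ''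
    stdSimplex ℝ (X × Y)

/-- The exponent `E_r^FR(R_w)`, the minimum of `outerValues`. -/
def frExponent (P : X × Y → ℝ) (a : (X × Y → ℝ) → ℝ) (Rw : ℝ) : EReal :=
  sInf (outerValues P a Rw)

end SingleLetter

section System

variable {X Y : Type*} [Fintype X] [DecidableEq X] [Fintype Y] [DecidableEq Y]

/-- The finite message alphabet `{0, 1, …, ⌊e^{nR}⌋}` of rate `R`. -/
abbrev Msg (R : ℝ) (n : ℕ) : Type := Fin (⌊Real.exp (n * R)⌋₊ + 1)

/-- The joint empirical distribution of a pair of sequences. -/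
def empDist {n : ℕ} (x : Fin n → X) (y : Fin n → Y) : X × Y → ℝ :=
  fun z => ((Finset.univ.filter fun i => x i = z.1 ∧ y i = z.2).card : ℝ) / n

/-- Probability of a pair of sequences under the memoryless joint source `P`. -/
def sourceProb {n : ℕ} (P : X × Y → ℝ) (x : Fin n → X) (y : Fin n → Y) : ℝ :=
  ∏ i, P (x i, y i)

/-- `P̃(s | y, w)`, the probability that the generalized stochastic likelihood decoder with
metric `a`, for the encoder with helper bins `f` and key bins `g`, outputs the key `s`. -/
def decoderProb {n : ℕ} {W S : Type*} [DecidableEq W] [DecidableEq S]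
    (a : (X × Y → ℝ) → ℝ) (f : (Fin n → X) → W) (g : (Fin n → X) → S)
    (y : Fin n → Y) (w : W) (s : S) : ℝ :=
  (∑ x : Fin n → X, if f x = w ∧ g x = s then Real.exp (n * a (empDist x y)) else 0) /
    (∑ x : Fin n → X, if f x = w then Real.exp (n * a (empDist x y)) else 0)

/-- `Pr{Ŝ ≠ S}` for the fixed encoder `(f, g)`: the pair `(x, y)` is drawn from the source, the key
is `g x`, the helper message is `f x`, and the key is estimated by the stochastic decoder. -/
def falseReject {n : ℕ} {W S : Type*} [DecidableEq W] [Fintype S] [DecidableEq S]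
    (P : X × Y → ℝ) (a : (X × Y → ℝ) → ℝ)
    (f : (Fin n → X) → W) (g : (Fin n → X) → S) : ℝ :=
  ∑ x : Fin n → X, ∑ y : Fin n → Y,
    sourceProb P x y * ∑ s ∈ Finset.univ.filter (fun s => s ≠ g x), decoderProb a f g y (f x) s

/-- Probability of the encoder `(f, g)` in the random-binning ensemble: the bins `f x` and `g x`,
over all `x`, are mutually independent and uniform on `W` and `S`. -/
def encoderProb {n : ℕ} {W S : Type*} [Fintype W] [Fintype S]
    (_f : (Fin n → X) → W) (_g : (Fin n → X) → S) : ℝ :=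
  (∏ _x : Fin n → X, (1 / (Fintype.card W : ℝ))) * ∏ _x : Fin n → X, (1 / (Fintype.card S : ℝ))

/-- The ensemble-average false-reject probability at block length `n`. -/
def avgFalseReject (P : X × Y → ℝ) (a : (X × Y → ℝ) → ℝ) (Rw Rs : ℝ) (n : ℕ) : ℝ :=
  ∑ f : (Fin n → X) → Msg Rw n, ∑ g : (Fin n → X) → Msg Rs n,
    encoderProb f g * falseReject P a f g

end System

end Biometric

end

set_option linter.unusedSectionVars false

/-! Fix the source pair `(x, y)`. An error occurs when the decoder picks some `x'` in the helper bin
of `x` whose key differs from that of `x`. For `x' ≠ x` the keys differ with probability `1 -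
1/|S|`, independently of the helper bins, and this factor lies between `1/2` and `1`; hence `Rs`
cannot affect the exponent (`avgFalseReject_eq`). What remains is the mean posterior mass of the
other members of the bin (`binError`).

By the method of types, about `exp(n H_Q(X|Y))` sequences have joint type `Q` with `y`, each in the
bin of `x` with probability about `exp(-n Rw)`. For the upper bound, a competitor receives posterior
mass at most `min 1 (s x' / s x)`, which produces the inner `[·]_+`; the trivial bound 1 on the
total produces the outer one (`binMean_binError_le_exp`). Summing over polynomially many types and
using `P^n = exp(-n D) · Q^n` on the type class of `Q` gives the upper bound on the probability
(`avgFalseReject_le`).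

For the matching lower bound, let `N` count the bin mates in a conditionally typical set. A
second-moment argument gives `E[N/(c+N)] ≥ μ/(c+1+μ)` with `μ = E N` (`le_binMean_binMates_div`),
which has the exponent of the doubly truncated expression (`exp_le_ratio`). Typical sets obtained
from Chebyshev's inequality replace exact types, so no distribution has to be approximated by types;
continuity of `a` absorbs the deviations. The optimal channel is first mixed with the uniform one,
so that its logarithms are finite and `x` itself has vanishing conditional probability. -/

namespace Biometric

/-! ### Continuity, compactness and attainment of the minima -/

section SingleLetterLemmas

open Real

variable {X Y : Type*} [Fintype X] [Fintype Y]

theorem posPart_nonneg (t : ℝ) : 0 ≤ posPart t := le_max_left _ _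

theorem le_posPart (t : ℝ) : t ≤ posPart t := le_max_right _ _

theorem continuous_posPart : Continuous posPart := continuous_const.max continuous_id

theorem marginalY_nonneg {Q : X × Y → ℝ} (hQ : ∀ z, 0 ≤ Q z) (y : Y) : 0 ≤ marginalY Q y :=
  Finset.sum_nonneg fun _ _ => hQ _

theorem le_marginalY {Q : X × Y → ℝ} (hQ : ∀ z, 0 ≤ Q z) (x : X) (y : Y) :
    Q (x, y) ≤ marginalY Q y :=
  Finset.single_le_sum (f := fun x => Q (x, y)) (fun _ _ => hQ _) (Finset.mem_univ x)

theorem sum_marginalY (Q : X × Y → ℝ) : ∑ y, marginalY Q y = ∑ z, Q z := by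
  simp only [marginalY]
  rw [Fintype.sum_prod_type, Finset.sum_comm]

theorem marginalY_joint (QY : Y → ℝ) {V : Y → X → ℝ} (hV : V ∈ channels X Y) (y : Y) :
    marginalY (joint QY V) y = QY y := by
  simp only [marginalY, joint, ← Finset.mul_sum, (hV y).2, mul_one]

theorem joint_mem_stdSimplex {Q : X × Y → ℝ} (hQ : Q ∈ stdSimplex ℝ (X × Y)) {V : Y → X → ℝ}
    (hV : V ∈ channels X Y) : joint (marginalY Q) V ∈ stdSimplex ℝ (X × Y) := by
  refine ⟨fun z => mul_nonneg (marginalY_nonneg hQ.1 _) ((hV _).1 _), ?_⟩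
  rw [← sum_marginalY, ← hQ.2, ← sum_marginalY]
  exact Finset.sum_congr rfl fun y _ => marginalY_joint _ hV y

/-- The chain rule `H(X|Y) = H(X,Y) - H(Y)`; unlike the quotient inside the logarithm, this form is
visibly continuous up to the boundary of the simplex. -/
theorem condEntropy_eq_negMulLog {Q : X × Y → ℝ} (hQ : ∀ z, 0 ≤ Q z) :
    condEntropy Q = ∑ z, negMulLog (Q z) - ∑ y, negMulLog (marginalY Q y) := by
  have key : ∀ x y, Q (x, y) * log (Q (x, y) / marginalY Q y) =
      Q (x, y) * log (marginalY Q y) * (-1) - negMulLog (Q (x, y)) := by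
    intro x y
    rcases (hQ (x, y)).eq_or_lt with h | h
    · simp [← h]
    · rw [log_div h.ne' (h.trans_le (le_marginalY hQ x y)).ne', negMulLog]; ring
  have h2 : ∑ x, ∑ y, Q (x, y) * log (marginalY Q y) = -∑ y, negMulLog (marginalY Q y) := by
    rw [Finset.sum_comm, ← Finset.sum_neg_distrib]
    refine Finset.sum_congr rfl fun y _ => ?_
    rw [← Finset.sum_mul, negMulLog]
    simp [marginalY]
  simp only [condEntropy, key, Finset.sum_sub_distrib, ← Finset.sum_mul, h2]
  rw [Fintype.sum_prod_type]
  ring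

theorem continuous_marginalY : Continuous (marginalY : (X × Y → ℝ) → Y → ℝ) := by
  refine continuous_pi fun y => ?_
  simp only [marginalY]
  fun_prop

theorem continuousOn_condEntropy :
    ContinuousOn (condEntropy : (X × Y → ℝ) → ℝ) {Q | ∀ z, 0 ≤ Q z} := by
  have : Continuous fun Q : X × Y → ℝ =>
      ∑ z, negMulLog (Q z) - ∑ y, negMulLog (marginalY Q y) := by
    refine Continuous.sub ?_ ?_
    · exact continuous_finsetSum _ fun z _ => continuous_negMulLog.comp (continuous_apply z)
    · exact continuous_finsetSum _ fun y _ => continuous_negMulLog.comp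
        ((continuous_apply y).comp continuous_marginalY)
  exact this.continuousOn.congr fun Q hQ => condEntropy_eq_negMulLog hQ

theorem isCompact_channels : IsCompact (channels X Y) := by
  have : channels X Y = Set.pi Set.univ fun _ => stdSimplex ℝ X := by
    ext V; simp [channels]
  rw [this]
  exact isCompact_univ_pi fun _ => isCompact_stdSimplex ℝ X

theorem channels_nonempty [Nonempty X] : (channels X Y).Nonempty := by
  classical
  exact ⟨fun _ => Pi.single (Classical.arbitrary X) 1, fun _ => single_mem_stdSimplex ℝ _⟩

/-- The objective of the inner minimisation. -/
noncomputable def innerObjective (a : (X × Y → ℝ) → ℝ) (Rw : ℝ) (Q₀ : X × Y → ℝ)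
    (V : Y → X → ℝ) : ℝ :=
  posPart (Rw - condEntropy (joint (marginalY Q₀) V)
      + posPart (a Q₀ - a (joint (marginalY Q₀) V)))

theorem continuousOn_innerObjective {a : (X × Y → ℝ) → ℝ}
    (ha : ContinuousOn a (stdSimplex ℝ (X × Y))) (Rw : ℝ) :
    ContinuousOn (fun p : (X × Y → ℝ) × (Y → X → ℝ) => innerObjective a Rw p.1 p.2)
      (stdSimplex ℝ (X × Y) ×ˢ channels X Y) := by
  have hj : Continuous fun p : (X × Y → ℝ) × (Y → X → ℝ) => joint (marginalY p.1) p.2 := by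
    refine continuous_pi fun z => ?_
    exact ((continuous_apply z.2).comp (continuous_marginalY.comp continuous_fst)).mul
      ((continuous_apply z.1).comp ((continuous_apply z.2).comp continuous_snd))
  have hm : Set.MapsTo (fun p : (X × Y → ℝ) × (Y → X → ℝ) => joint (marginalY p.1) p.2)
      (stdSimplex ℝ (X × Y) ×ˢ channels X Y) (stdSimplex ℝ (X × Y)) :=
    fun p hp => joint_mem_stdSimplex hp.1 hp.2
  refine continuous_posPart.comp_continuousOn (((continuousOn_const).sub ?_).add
    (continuous_posPart.comp_continuousOn (ContinuousOn.sub ?_ ?_)))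
  · exact (continuousOn_condEntropy.mono fun Q hQ => hQ.1).comp hj.continuousOn hm
  · exact ha.comp continuousOn_fst fun p hp => hp.1
  · exact ha.comp hj.continuousOn hm

theorem isLeast_innerValues [Nonempty X] {a : (X × Y → ℝ) → ℝ}
    (ha : ContinuousOn a (stdSimplex ℝ (X × Y))) (Rw : ℝ) {Q₀ : X × Y → ℝ}
    (hQ₀ : Q₀ ∈ stdSimplex ℝ (X × Y)) :
    IsLeast (innerValues a Rw Q₀) (innerExponent a Rw Q₀) := by
  have hc : ContinuousOn (innerObjective a Rw Q₀) (channels X Y) :=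
    (continuousOn_innerObjective ha Rw).comp (f := fun V => (Q₀, V))
      (by fun_prop) fun V hV => ⟨hQ₀, hV⟩
  exact (isCompact_channels.image_of_continuousOn hc).isLeast_sInf (channels_nonempty.image _)

theorem innerExponent_le [Nonempty X] {a : (X × Y → ℝ) → ℝ}
    (ha : ContinuousOn a (stdSimplex ℝ (X × Y))) (Rw : ℝ) {Q₀ : X × Y → ℝ}
    (hQ₀ : Q₀ ∈ stdSimplex ℝ (X × Y)) {V : Y → X → ℝ} (hV : V ∈ channels X Y) :
    innerExponent a Rw Q₀ ≤ innerObjective a Rw Q₀ V :=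
  (isLeast_innerValues ha Rw hQ₀).2 ⟨V, hV, rfl⟩

theorem continuous_relEntropySum {Z : Type*} [Fintype Z] (P : Z → ℝ) :
    ContinuousOn (fun Q : Z → ℝ => ∑ z, Q z * log (Q z / P z)) {Q | ∀ z, P z = 0 → Q z = 0} := by
  have : Continuous fun Q : Z → ℝ => ∑ z, (-negMulLog (Q z) - Q z * log (P z)) :=
    continuous_finsetSum _ fun z _ =>
      (continuous_negMulLog.comp (continuous_apply z)).neg.sub
        ((continuous_apply z).mul continuous_const)
  refine this.continuousOn.congr fun Q hQ => Finset.sum_congr rfl fun z _ => ?_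
  by_cases h : Q z = 0
  · simp [h]
  · rw [log_div h (fun h' => h (hQ z h')), negMulLog]; ring

/-- Minimising over `(Q, V)` jointly avoids proving that the inner minimum is continuous in `Q`.
Restricting to supports inside that of `P` keeps the divergence finite and continuous on a compact
set, which contains `P` itself. -/
theorem exists_optimal_pair [Nonempty X] {P : X × Y → ℝ} (hP : P ∈ stdSimplex ℝ (X × Y))
    {a : (X × Y → ℝ) → ℝ} (ha : ContinuousOn a (stdSimplex ℝ (X × Y))) (Rw : ℝ) :
    ∃ Q ∈ stdSimplex ℝ (X × Y), ∃ V ∈ channels X Y, (∀ z, P z = 0 → Q z = 0) ∧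
      (∀ Q' ∈ stdSimplex ℝ (X × Y), ∀ V' ∈ channels X Y, (∀ z, P z = 0 → Q' z = 0) →
        ∑ z, Q z * log (Q z / P z) + innerObjective a Rw Q V ≤
          ∑ z, Q' z * log (Q' z / P z) + innerObjective a Rw Q' V') := by
  set K : Set (X × Y → ℝ) := stdSimplex ℝ (X × Y) ∩ {Q | ∀ z, P z = 0 → Q z = 0} with hK
  have hKc : IsCompact K := by
    refine (isCompact_stdSimplex ℝ (X × Y)).inter_right ?_
    simp only [Set.ofPred_forall]
    exact isClosed_iInter fun z => isClosed_iInter fun _ =>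
      isClosed_eq (continuous_apply z) continuous_const
  have hne : (K ×ˢ channels X Y).Nonempty :=
    Set.Nonempty.prod ⟨P, hP, fun _ h => h⟩ channels_nonempty
  have hc : ContinuousOn (fun p : (X × Y → ℝ) × (Y → X → ℝ) =>
      ∑ z, p.1 z * log (p.1 z / P z) + innerObjective a Rw p.1 p.2) (K ×ˢ channels X Y) := by
    refine ContinuousOn.add ?_ ((continuousOn_innerObjective ha Rw).mono ?_)
    · exact (continuous_relEntropySum P).comp continuousOn_fst fun p hp => hp.1.2
    · exact Set.prod_mono Set.inter_subset_left le_rfl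
  obtain ⟨⟨Q, V⟩, hQV, hmin⟩ := (hKc.prod isCompact_channels).exists_isMinOn hne hc
  exact ⟨Q, hQV.1.1, V, hQV.2, hQV.1.2, fun Q' hQ' V' hV' h => hmin (a := (Q', V')) ⟨⟨hQ', h⟩, hV'⟩⟩

/-- The outer minimum is attained, and it is the finite value of the joint minimisation. -/
theorem isLeast_outerValues [Nonempty X] {P : X × Y → ℝ} {a : (X × Y → ℝ) → ℝ}
    (ha : ContinuousOn a (stdSimplex ℝ (X × Y))) {Rw : ℝ} {Q : X × Y → ℝ}
    (hQ : Q ∈ stdSimplex ℝ (X × Y)) {V : Y → X → ℝ} (hV : V ∈ channels X Y)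
    (hQP : ∀ z, P z = 0 → Q z = 0)
    (hmin : ∀ Q' ∈ stdSimplex ℝ (X × Y), ∀ V' ∈ channels X Y, (∀ z, P z = 0 → Q' z = 0) →
        ∑ z, Q z * log (Q z / P z) + innerObjective a Rw Q V ≤
          ∑ z, Q' z * log (Q' z / P z) + innerObjective a Rw Q' V') :
    IsLeast (outerValues P a Rw)
      ((∑ z, Q z * log (Q z / P z) + innerObjective a Rw Q V : ℝ) : EReal) := by
  have hin : innerExponent a Rw Q = innerObjective a Rw Q V := by
    refine le_antisymm (innerExponent_le ha Rw hQ hV) ?_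
    obtain ⟨V', hV', h⟩ := (isLeast_innerValues ha Rw hQ).1
    rw [← h]
    have := hmin Q hQ V' hV' hQP
    simp only [innerObjective] at this ⊢
    linarith
  constructor
  · refine ⟨Q, hQ, ?_⟩
    simp only [divergence, if_pos hQP, hin]
    norm_cast
  · rintro _ ⟨Q', hQ', rfl⟩
    by_cases h : ∀ z, P z = 0 → Q' z = 0
    · obtain ⟨V', hV', hV'e⟩ := (isLeast_innerValues ha Rw hQ').1
      simp only [divergence, if_pos h]
      rw [← hV'e]
      exact_mod_cast hmin Q' hQ' V' hV' h
    · simp only [divergence, if_neg h]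
      rw [EReal.top_add_coe]
      exact le_top

end SingleLetterLemmas

/-! ### Moments and posterior mass in a uniformly random bin -/

section RandomBinning

variable {A W : Type*} [Fintype A] [DecidableEq A] [Fintype W] [DecidableEq W]

/-- The expectation of `F f` for a uniformly random bin assignment `f : A → W`. -/
noncomputable def binMean (F : (A → W) → ℝ) : ℝ :=
  ∑ f : A → W, (∏ _x : A, (1 / (Fintype.card W : ℝ))) * F f

theorem binMean_mono {F G : (A → W) → ℝ} (h : ∀ f, F f ≤ G f) : binMean F ≤ binMean G :=
  Finset.sum_le_sum fun f _ => mul_le_mul_of_nonneg_left (h f) (by positivity)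

theorem binMean_sum {ι : Type*} (s : Finset ι) (F : ι → (A → W) → ℝ) :
    binMean (fun f => ∑ i ∈ s, F i f) = ∑ i ∈ s, binMean (F i) := by
  simp only [binMean, Finset.mul_sum]
  exact Finset.sum_comm

theorem binMean_const_mul (c : ℝ) (F : (A → W) → ℝ) :
    binMean (fun f => c * F f) = c * binMean F := by
  simp only [binMean, Finset.mul_sum]
  exact Finset.sum_congr rfl fun f _ => by ring

theorem binMean_add (F G : (A → W) → ℝ) :
    binMean (fun f => F f + G f) = binMean F + binMean G := by
  simp only [binMean, mul_add, Finset.sum_add_distrib]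

theorem binMean_forall_eq [Nonempty W] (S : Finset A) (w : W) :
    binMean (fun f : A → W => if ∀ a ∈ S, f a = w then (1 : ℝ) else 0) =
      (1 / (Fintype.card W : ℝ)) ^ S.card := by
  have hM : (Fintype.card W : ℝ) ≠ 0 := by simp
  have h1 : ∀ f : A → W, (∏ _x : A, (1 / (Fintype.card W : ℝ))) *
      (if ∀ a ∈ S, f a = w then (1 : ℝ) else 0) =
      ∏ a : A, (1 / (Fintype.card W : ℝ)) * (if a ∈ S then if f a = w then 1 else 0 else 1) := by
    intro f
    rw [Finset.prod_mul_distrib, Finset.prod_ite_mem]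
    simp [Finset.prod_ite_zero]
  have h2 := Finset.prod_univ_sum (fun _ : A => (Finset.univ : Finset W))
    (fun a v => (1 / (Fintype.card W : ℝ)) * (if a ∈ S then if v = w then 1 else 0 else 1))
  rw [Fintype.piFinset_univ] at h2
  simp only [binMean, h1, ← h2]
  have h3 : ∀ a : A, ∑ v : W, (1 / (Fintype.card W : ℝ)) *
      (if a ∈ S then if v = w then 1 else 0 else 1) =
      if a ∈ S then 1 / (Fintype.card W : ℝ) else 1 := by
    intro a
    split_ifs
    · simp
    · simp [hM]
  simp only [h3]
  rw [Finset.prod_ite_mem]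
  simp

/-- Split according to the common bin `w`: the |W| choices cancel one factor `1/|W|`. -/
theorem binMean_same_bin [Nonempty W] {S : Finset A} {x : A} (hx : x ∈ S) :
    binMean (fun f : A → W => if ∀ a ∈ S, f a = f x then (1 : ℝ) else 0) =
      (1 / (Fintype.card W : ℝ)) ^ (S.card - 1) := by
  have hM : (Fintype.card W : ℝ) ≠ 0 := by simp
  have h : ∀ f : A → W, (if ∀ a ∈ S, f a = f x then (1 : ℝ) else 0) =
      ∑ w : W, if ∀ a ∈ S, f a = w then (1 : ℝ) else 0 := by
    intro f
    rw [Finset.sum_eq_single (f x)]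
    · intro w _ hw
      rw [if_neg]
      exact fun h => hw (h x hx).symm
    · simp
  simp only [h, binMean_sum, binMean_forall_eq]
  have : S.card = S.card - 1 + 1 := by
    have := Finset.card_pos.2 ⟨x, hx⟩; omega
  rw [Finset.sum_const, Finset.card_univ, nsmul_eq_mul]
  conv_lhs => rw [this, pow_succ]
  field_simp

theorem binMean_const [Nonempty W] (c : ℝ) : binMean (fun _ : A → W => c) = c := by
  have hM : (Fintype.card W : ℝ) ≠ 0 := by simp
  simp [binMean, hM]

theorem binMean_pair [Nonempty W] {x x' : A} (h : x' ≠ x) :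
    binMean (fun f : A → W => if f x' = f x then (1 : ℝ) else 0) = 1 / Fintype.card W := by
  have := binMean_same_bin (W := W) (S := {x, x'}) (x := x) (by simp)
  rw [Finset.card_pair h.symm] at this
  simpa using this

theorem binMean_triple [Nonempty W] {x x' x'' : A} (h : x' ≠ x) (h' : x'' ≠ x) (h'' : x' ≠ x'') :
    binMean (fun f : A → W => if f x' = f x ∧ f x'' = f x then (1 : ℝ) else 0) =
      (1 / Fintype.card W : ℝ) ^ 2 := by
  have := binMean_same_bin (W := W) (S := {x, x', x''}) (x := x) (by simp)
  rw [Finset.card_eq_three.2 ⟨x, x', x'', h.symm, h'.symm, h'', rfl⟩] at this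
  simpa using this

theorem binMean_pair_ne [Nonempty W] (x x' : A) :
    binMean (fun f : A → W => if f x' ≠ f x then (1 : ℝ) else 0) =
      if x' ≠ x then 1 - 1 / (Fintype.card W : ℝ) else 0 := by
  split_ifs with h
  · have h1 := binMean_add (fun f : A → W => if f x' ≠ f x then (1 : ℝ) else 0)
      (fun f : A → W => if f x' = f x then (1 : ℝ) else 0)
    have h2 : (fun f : A → W => (if f x' ≠ f x then (1 : ℝ) else 0) +
        (if f x' = f x then (1 : ℝ) else 0)) = fun _ => 1 := by
      funext f; by_cases h : f x' = f x <;> simp [h]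
    rw [h2, binMean_const, binMean_pair h] at h1
    linarith
  · push Not at h
    subst h
    simpa using binMean_const (A := A) (W := W) 0

/-- The number of elements of `T` in the bin of `x`. -/
noncomputable def binMates (T : Finset A) (x : A) (f : A → W) : ℝ :=
  ∑ x' ∈ T, if f x' = f x then (1 : ℝ) else 0

theorem binMates_nonneg (T : Finset A) (x : A) (f : A → W) : 0 ≤ binMates T x f :=
  Finset.sum_nonneg fun _ _ => by split_ifs <;> norm_num

theorem binMean_binMates [Nonempty W] {T : Finset A} {x : A} (hx : x ∉ T) :
    binMean (fun f : A → W => binMates T x f) = T.card / Fintype.card W := by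
  simp only [binMates, binMean_sum]
  rw [Finset.sum_congr rfl fun x' hx' => binMean_pair (ne_of_mem_of_not_mem hx' hx)]
  rw [Finset.sum_const, nsmul_eq_mul]
  ring

theorem binMean_binMates_sq_le [Nonempty W] {T : Finset A} {x : A} (hx : x ∉ T) :
    binMean (fun f : A → W => binMates T x f ^ 2) ≤
      T.card / Fintype.card W + (T.card / Fintype.card W) ^ 2 := by
  set p : ℝ := 1 / Fintype.card W with hp
  have hp0 : 0 ≤ p := by positivity
  have h1 : ∀ f : A → W, binMates T x f ^ 2 =
      ∑ x' ∈ T, ∑ x'' ∈ T, if f x' = f x ∧ f x'' = f x then (1 : ℝ) else 0 := by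
    intro f
    simp only [binMates, sq, Finset.sum_mul_sum]
    refine Finset.sum_congr rfl fun a _ => Finset.sum_congr rfl fun b _ => ?_
    by_cases h1 : f a = f x <;> by_cases h2 : f b = f x <;> simp [h1, h2]
  simp only [h1, binMean_sum]
  have h2 : ∀ x' ∈ T, ∀ x'' ∈ T,
      binMean (fun f : A → W => if f x' = f x ∧ f x'' = f x then (1 : ℝ) else 0) ≤
        (if x' = x'' then p else 0) + p ^ 2 := by
    intro x' hx' x'' hx''
    by_cases h : x' = x''
    · subst h
      simp only [and_self, if_true, binMean_pair (ne_of_mem_of_not_mem hx' hx)]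
      nlinarith
    · rw [binMean_triple (ne_of_mem_of_not_mem hx' hx) (ne_of_mem_of_not_mem hx'' hx) h, if_neg h]
      linarith
  refine (Finset.sum_le_sum fun x' hx' => Finset.sum_le_sum fun x'' hx'' =>
    h2 x' hx' x'' hx'').trans (le_of_eq ?_)
  simp only [Finset.sum_add_distrib, Finset.sum_ite_eq, Finset.sum_const, nsmul_eq_mul]
  rw [Finset.sum_congr rfl fun x' hx' => if_pos hx']
  simp only [Finset.sum_const, nsmul_eq_mul, hp]
  ring

/-- Cauchy–Schwarz with `N = (N/(c+N))^(1/2) · (N(c+N))^(1/2)`. Distinct competitors fall into the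
bin of `x` pairwise independently, so `E N² ≤ μ + μ²`, and `μ² ≤ E[N/(c+N)] · μ(c+1+μ)`. -/
theorem le_binMean_binMates_div [Nonempty W] {T : Finset A} {x : A} (hx : x ∉ T) {c : ℝ}
    (hc : 0 < c) :
    (T.card / Fintype.card W : ℝ) / (c + 1 + T.card / Fintype.card W) ≤
      binMean (fun f : A → W => binMates T x f / (c + binMates T x f)) := by
  set μ : ℝ := T.card / Fintype.card W with hμ
  have hμ0 : 0 ≤ μ := by positivity
  have hcs : binMean (fun f : A → W => binMates T x f) ^ 2 ≤
      binMean (fun f : A → W => binMates T x f / (c + binMates T x f)) *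
      binMean (fun f : A → W => c * binMates T x f + binMates T x f ^ 2) := by
    refine Finset.sum_sq_le_sum_mul_sum_of_sq_le_mul _ (fun f _ => ?_) (fun f _ => ?_)
      (fun f _ => ?_)
    · have := binMates_nonneg T x f
      positivity
    · have := binMates_nonneg T x f
      positivity
    · have := binMates_nonneg T x f
      refine le_of_eq ?_
      field_simp
  rw [binMean_binMates hx, binMean_add, binMean_const_mul, binMean_binMates hx, ← hμ] at hcs
  have h2 := binMean_binMates_sq_le (W := W) hx
  rw [← hμ] at h2
  have hF : 0 ≤ binMean (fun f : A → W => binMates T x f / (c + binMates T x f)) := by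
    refine Finset.sum_nonneg fun f _ => ?_
    have := binMates_nonneg T x f
    positivity
  rcases hμ0.eq_or_lt with h0 | h0
  · rw [← h0]; simpa using hF
  rw [div_le_iff₀ (by positivity)]
  have h3 := hcs.trans (mul_le_mul_of_nonneg_left (add_le_add_right h2 (c * μ)) hF)
  nlinarith

/-- The posterior mass that a decoder with scores `s` puts on the elements of the bin of `x`
other than `x`. -/
noncomputable def binError (s : A → ℝ) (x : A) (f : A → W) : ℝ :=
  (∑ x', if x' ≠ x ∧ f x' = f x then s x' else 0) / ∑ x', if f x' = f x then s x' else 0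

theorem sum_bin_eq (s : A → ℝ) (x : A) (f : A → W) :
    (∑ x', if f x' = f x then s x' else 0) =
      s x + ∑ x', if x' ≠ x ∧ f x' = f x then s x' else 0 := by
  rw [← Finset.add_sum_erase _ _ (Finset.mem_univ x), if_pos rfl,
    ← Finset.add_sum_erase _ (fun x' => if x' ≠ x ∧ f x' = f x then s x' else 0)
      (Finset.mem_univ x)]
  simp only [ne_eq, not_true_eq_false, false_and, if_false, zero_add]
  congr 1
  refine Finset.sum_congr rfl fun x' hx' => ?_
  simp [(Finset.mem_erase.1 hx').1]

theorem sum_others_nonneg {s : A → ℝ} (hs : ∀ a, 0 < s a) (x : A) (f : A → W) :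
    0 ≤ ∑ x', if x' ≠ x ∧ f x' = f x then s x' else 0 :=
  Finset.sum_nonneg fun x' _ => by split_ifs <;> [exact (hs x').le; exact le_rfl]

theorem binError_nonneg {s : A → ℝ} (hs : ∀ a, 0 < s a) (x : A) (f : A → W) :
    0 ≤ binError s x f := by
  have := sum_others_nonneg hs x f
  have := hs x
  rw [binError, sum_bin_eq]
  positivity

theorem binMean_binError_le_one [Nonempty W] {s : A → ℝ} (hs : ∀ a, 0 < s a) (x : A) :
    binMean (fun f : A → W => binError s x f) ≤ 1 := by
  rw [← binMean_const (A := A) (W := W) 1]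
  refine binMean_mono fun f => ?_
  rw [binError, sum_bin_eq]
  have := sum_others_nonneg hs x f
  have := hs x
  exact div_le_one_of_le₀ (by linarith) (by linarith)

/-- For a competitor `x'` in the bin, the denominator is at least `s x'` and at least `s x`, so its
share is at most `min 1 (s x' / s x)`. -/
theorem binMean_binError_le_sum [Nonempty W] {s : A → ℝ} (hs : ∀ a, 0 < s a) (x : A) :
    binMean (fun f : A → W => binError s x f) ≤
      ∑ x', 1 / (Fintype.card W : ℝ) * min 1 (s x' / s x) := by
  have h1 : ∀ f : A → W, binError s x f ≤
      ∑ x' ∈ Finset.univ.erase x, min 1 (s x' / s x) * (if f x' = f x then 1 else 0) := by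
    intro f
    rw [binError, Finset.sum_div, ← Finset.add_sum_erase _ _ (Finset.mem_univ x)]
    simp only [ne_eq, not_true_eq_false, false_and, if_false, zero_div, zero_add]
    refine Finset.sum_le_sum fun x' hx' => ?_
    have hne := (Finset.mem_erase.1 hx').1
    by_cases h : f x' = f x
    · have hx0 := hs x
      have hx1 := hs x'
      have hle : ∀ z : A, f z = f x → s z ≤ ∑ x', if f x' = f x then s x' else 0 := by
        intro z hz
        refine le_trans (by rw [if_pos hz]) (Finset.single_le_sum
          (f := fun x' => if f x' = f x then s x' else 0) (fun y _ => ?_) (Finset.mem_univ z))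
        split_ifs <;> [exact (hs y).le; exact le_rfl]
      simp only [hne, h, not_false_eq_true, and_self, if_true, mul_one]
      refine le_min ?_ ?_
      · exact div_le_one_of_le₀ (hle x' h) ((hs x').le.trans (hle x' h))
      · exact div_le_div_of_nonneg_left hx1.le hx0 (hle x rfl)
    · simp [h]
  refine (binMean_mono h1).trans ?_
  simp only [binMean_sum, binMean_const_mul]
  rw [Finset.sum_congr rfl fun x' hx' => by rw [binMean_pair (Finset.mem_erase.1 hx').1]]
  refine (Finset.sum_le_univ_sum_of_nonneg fun x' => ?_).trans
    (le_of_eq (Finset.sum_congr rfl fun _ _ => mul_comm _ _))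
  have := hs x
  have := hs x'
  positivity

/-- The error `B/(s x + B)` increases in the competing mass `B` and decreases in `s x`. Using `B ≥
s₁ N` and `s x ≤ s₀` leaves `N/(s₀/s₁ + N)`. -/
theorem le_binMean_binError [Nonempty W] {s : A → ℝ} (hs : ∀ a, 0 < s a) {T : Finset A} {x : A}
    (hx : x ∉ T) {s₀ s₁ : ℝ} (h₁ : 0 < s₁) (h₀ : s x ≤ s₀) (hT : ∀ x' ∈ T, s₁ ≤ s x') :
    (T.card / Fintype.card W : ℝ) / (s₀ / s₁ + 1 + T.card / Fintype.card W) ≤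
      binMean (fun f : A → W => binError s x f) := by
  have hs0 : 0 < s₀ := (hs x).trans_le h₀
  refine (le_binMean_binMates_div hx (div_pos hs0 h₁)).trans (binMean_mono fun f => ?_)
  have hN := binMates_nonneg T x f
  have hB : s₁ * binMates T x f ≤ ∑ x', if x' ≠ x ∧ f x' = f x then s x' else 0 := by
    rw [binMates, Finset.mul_sum]
    refine le_trans (Finset.sum_le_sum (g := fun x' => if x' ≠ x ∧ f x' = f x then s x' else 0)
      fun x' hx' => ?_) (Finset.sum_le_univ_sum_of_nonneg fun x' => ?_)
    · by_cases h : f x' = f x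
      · simp [h, ne_of_mem_of_not_mem hx' hx, hT x' hx']
      · simp [h]
    · split_ifs <;> [exact (hs x').le; exact le_rfl]
  rw [binError, sum_bin_eq]
  set B := ∑ x', if x' ≠ x ∧ f x' = f x then s x' else 0
  have hB0 : 0 ≤ B := sum_others_nonneg hs x f
  have hx0 := hs x
  rw [div_le_div_iff₀ (by positivity) (by positivity)]
  have e : s₀ / s₁ * s₁ = s₀ := by field_simp
  have : binMates T x f * s x ≤ B * (s₀ / s₁) := by
    calc binMates T x f * s x ≤ binMates T x f * s₀ := by gcongr
      _ = s₁ * binMates T x f * (s₀ / s₁) := by rw [← e]; field_simp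
      _ ≤ B * (s₀ / s₁) := by gcongr
  nlinarith

end RandomBinning

/-! ### Removing the key from the ensemble average -/

section Average

variable {X Y : Type*} [Fintype X] [DecidableEq X] [Fintype Y] [DecidableEq Y]

theorem sum_decoderProb_ne {n : ℕ} {W S : Type*} [DecidableEq W] [Fintype S] [DecidableEq S]
    (a : (X × Y → ℝ) → ℝ) (f : (Fin n → X) → W) (g : (Fin n → X) → S) (x : Fin n → X)
    (y : Fin n → Y) :
    ∑ s ∈ Finset.univ.filter (fun s => s ≠ g x), decoderProb a f g y (f x) s =
      ∑ x', (if g x' ≠ g x then (1 : ℝ) else 0) *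
        ((if f x' = f x then Real.exp (n * a (empDist x' y)) else 0) /
          ∑ x'', if f x'' = f x then Real.exp (n * a (empDist x'' y)) else 0) := by
  simp only [decoderProb, Finset.sum_div]
  rw [Finset.sum_comm]
  refine Finset.sum_congr rfl fun x' _ => ?_
  by_cases h : f x' = f x
  · by_cases h' : g x' = g x
    · simp only [h, h', true_and, ne_eq, not_true_eq_false, if_false, zero_mul]
      refine Finset.sum_eq_zero fun s hs => ?_
      rw [if_neg (Ne.symm (Finset.mem_filter.1 hs).2), zero_div]
    · simp only [h, true_and, ne_eq, h', not_false_eq_true, if_true, one_mul]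
      rw [Finset.sum_eq_single (g x')]
      · simp
      · intro s _ hs
        rw [if_neg (Ne.symm hs), zero_div]
      · intro hs
        simp [h'] at hs
  · simp [h]

/-- The posterior weights depend on `f` only, so averaging over the independent `g` first multiplies
each competitor `x' ≠ x` by the same factor. -/
theorem avgFalseReject_eq (P : X × Y → ℝ) (a : (X × Y → ℝ) → ℝ) (Rw Rs : ℝ) (n : ℕ) :
    avgFalseReject P a Rw Rs n = (1 - 1 / (Fintype.card (Msg Rs n) : ℝ)) *
      ∑ x : Fin n → X, ∑ y : Fin n → Y, sourceProb P x y *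
        binMean (fun f : (Fin n → X) → Msg Rw n =>
          binError (fun x' => Real.exp (n * a (empDist x' y))) x f) := by
  have h1 : avgFalseReject P a Rw Rs n = binMean (fun f : (Fin n → X) → Msg Rw n =>
      binMean (fun g : (Fin n → X) → Msg Rs n => falseReject P a f g)) := by
    simp only [avgFalseReject, binMean, encoderProb, Finset.mul_sum, mul_assoc]
  have h2 : ∀ f : (Fin n → X) → Msg Rw n, ∀ (x : Fin n → X) (y : Fin n → Y),
      ∑ x', (if x' ≠ x then 1 - 1 / (Fintype.card (Msg Rs n) : ℝ) else 0) *
        ((if f x' = f x then Real.exp (n * a (empDist x' y)) else 0) /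
          ∑ x'', if f x'' = f x then Real.exp (n * a (empDist x'' y)) else 0) =
      (1 - 1 / (Fintype.card (Msg Rs n) : ℝ)) *
        binError (fun x' => Real.exp (n * a (empDist x' y))) x f := by
    intro f x y
    rw [binError, Finset.sum_div, Finset.mul_sum]
    refine Finset.sum_congr rfl fun x' _ => ?_
    by_cases h : x' = x <;> simp [h]
  have h3 : ∀ f : (Fin n → X) → Msg Rw n,
      binMean (fun g : (Fin n → X) → Msg Rs n => falseReject P a f g) =
      ∑ x : Fin n → X, ∑ y : Fin n → Y, sourceProb P x y *
        ((1 - 1 / (Fintype.card (Msg Rs n) : ℝ)) *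
        binError (fun x' => Real.exp (n * a (empDist x' y))) x f) := by
    intro f
    simp only [falseReject, sum_decoderProb_ne, binMean_sum, binMean_const_mul]
    refine Finset.sum_congr rfl fun x _ => Finset.sum_congr rfl fun y _ => ?_
    rw [← h2]
    congr 1
    refine Finset.sum_congr rfl fun x' _ => ?_
    rw [← binMean_pair_ne x x']
    simp only [mul_comm (if _ then (1 : ℝ) else 0), binMean_const_mul]
    rw [mul_comm]
  rw [h1]
  simp only [h3, binMean_sum, binMean_const_mul, Finset.mul_sum]
  refine Finset.sum_congr rfl fun x _ => Finset.sum_congr rfl fun y _ => ?_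
  ring

end Average

/-! ### Method of types and the upper bound on the error probability -/

section Types

variable {X Y : Type*} [Fintype X] [DecidableEq X] [Fintype Y] [DecidableEq Y]

theorem sum_apply_eq_empDist {n : ℕ} (x : Fin n → X) (y : Fin n → Y) (φ : X × Y → ℝ) :
    ∑ i, φ (x i, y i) = n * ∑ z, empDist x y z * φ z := by
  rcases Nat.eq_zero_or_pos n with rfl | hn
  · simp
  have hn' : (n : ℝ) ≠ 0 := by positivity
  rw [Finset.mul_sum]
  have : ∀ z, (n : ℝ) * (empDist x y z * φ z) =
      ∑ i, if x i = z.1 ∧ y i = z.2 then φ z else 0 := by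
    intro z
    rw [← Finset.sum_filter, Finset.sum_const, nsmul_eq_mul, empDist]
    field_simp
  simp only [this]
  rw [Finset.sum_comm]
  refine Finset.sum_congr rfl fun i _ => ?_
  rw [Finset.sum_eq_single (x i, y i)]
  · simp
  · rintro ⟨u, v⟩ _ h
    rw [if_neg]
    rintro ⟨rfl, rfl⟩
    exact h rfl
  · simp

theorem empDist_nonneg {n : ℕ} (x : Fin n → X) (y : Fin n → Y) (z : X × Y) :
    0 ≤ empDist x y z := by
  unfold empDist; positivity

theorem empDist_mem_stdSimplex {n : ℕ} (hn : 0 < n) (x : Fin n → X) (y : Fin n → Y) :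
    empDist x y ∈ stdSimplex ℝ (X × Y) := by
  refine ⟨empDist_nonneg x y, ?_⟩
  have h := sum_apply_eq_empDist x y fun _ => 1
  have hn' : (n : ℝ) ≠ 0 := by positivity
  simp only [Finset.sum_const, Finset.card_univ, Fintype.card_fin, nsmul_eq_mul, mul_one] at h
  field_simp at h
  linarith

theorem empDist_apply_pos {n : ℕ} (x : Fin n → X) (y : Fin n → Y) (i : Fin n) :
    0 < empDist x y (x i, y i) := by
  have hn : 0 < n := i.pos
  refine div_pos ?_ (by positivity)
  exact_mod_cast Finset.card_pos.2 ⟨i, by simp⟩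

theorem exists_of_empDist_ne_zero {n : ℕ} {x : Fin n → X} {y : Fin n → Y} {z : X × Y}
    (h : empDist x y z ≠ 0) : ∃ i, (x i, y i) = z := by
  by_contra! hc
  refine h ?_
  rw [empDist, Finset.filter_eq_empty_iff.2]
  · simp
  · intro i _ hi
    exact hc i (Prod.ext hi.1 hi.2)

/-- This places the joint type of every competitor with `y` among the candidates `Q_Y × Q_{X|Y}` of
the inner minimum. -/
theorem marginalY_empDist {n : ℕ} (x x' : Fin n → X) (y : Fin n → Y) :
    marginalY (empDist x y) = marginalY (empDist x' y) := by
  have key : ∀ x : Fin n → X, ∀ b, marginalY (empDist x y) b =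
      ((Finset.univ.filter fun i => y i = b).card : ℝ) / n := by
    intro x b
    simp only [marginalY, empDist, ← Finset.sum_div]
    congr 1
    rw [← Nat.cast_sum, Finset.card_eq_sum_card_fiberwise (f := x) (t := Finset.univ)
      (fun _ _ => Finset.mem_coe.2 (Finset.mem_univ _))]
    congr 1
    refine Finset.sum_congr rfl fun u _ => ?_
    congr 1
    ext i
    simp [and_comm]
  funext b
  rw [key, key]

theorem prod_apply_eq_exp {n : ℕ} (x : Fin n → X) (y : Fin n → Y) {h : X × Y → ℝ}
    (hpos : ∀ i, 0 < h (x i, y i)) :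
    ∏ i, h (x i, y i) = Real.exp (n * ∑ z, empDist x y z * Real.log (h z)) := by
  rw [← sum_apply_eq_empDist x y fun z => Real.log (h z), Real.exp_sum]
  exact Finset.prod_congr rfl fun i _ => (Real.exp_log (hpos i)).symm

theorem sum_prod_apply {n : ℕ} {Z : Type*} [Fintype Z] [DecidableEq Z] (h : Fin n → Z → ℝ) :
    ∑ x : Fin n → Z, ∏ i, h i (x i) = ∏ i, ∑ z, h i z := by
  rw [Finset.prod_univ_sum, Fintype.piFinset_univ]

theorem sum_sum_prod_apply {n : ℕ} (h : Fin n → X × Y → ℝ) :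
    ∑ x : Fin n → X, ∑ y : Fin n → Y, ∏ i, h i (x i, y i) = ∏ i, ∑ z, h i z := by
  have h1 : ∀ x : Fin n → X, ∑ y : Fin n → Y, ∏ i, h i (x i, y i) = ∏ i, ∑ b, h i (x i, b) :=
    fun x => sum_prod_apply fun i b => h i (x i, b)
  simp only [h1]
  rw [sum_prod_apply fun i u => ∑ b, h i (u, b)]
  simp only [Fintype.sum_prod_type]

variable (X Y) in
/-- A finite set containing all joint types of block length `n`. -/
noncomputable def jointTypes (n : ℕ) : Finset (X × Y → ℝ) :=
  open Classical in
  Finset.univ.image fun (c : X × Y → Fin (n + 1)) z => ((c z : ℕ) : ℝ) / n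

theorem card_jointTypes_le (n : ℕ) :
    (jointTypes X Y n).card ≤ (n + 1) ^ Fintype.card (X × Y) := by
  refine Finset.card_image_le.trans (le_of_eq ?_)
  rw [Finset.card_univ, Fintype.card_fun, Fintype.card_fin]

theorem empDist_mem_jointTypes {n : ℕ} (x : Fin n → X) (y : Fin n → Y) :
    empDist x y ∈ jointTypes X Y n := by
  classical
  refine Finset.mem_image.2 ⟨fun z => ⟨(Finset.univ.filter fun i => x i = z.1 ∧ y i = z.2).card,
    Nat.lt_succ_of_le ?_⟩, Finset.mem_univ _, rfl⟩
  exact (Finset.card_filter_le _ _).trans (by simp)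

/-- The conditional distribution of `X` given `Y` under `Q`. -/
noncomputable def condChannel (Q : X × Y → ℝ) (y : Y) (x : X) : ℝ :=
  -- The uniform default keeps this a channel; its value is irrelevant since `Q_Y(y) = 0` there.
  if marginalY Q y = 0 then 1 / Fintype.card X else Q (x, y) / marginalY Q y

theorem condChannel_mem [Nonempty X] {Q : X × Y → ℝ} (hQ : ∀ z, 0 ≤ Q z) :
    condChannel Q ∈ channels X Y := by
  intro y
  by_cases h : marginalY Q y = 0
  · refine ⟨fun x => ?_, ?_⟩
    · simp [condChannel, h]
    · simp [condChannel, h]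
  · refine ⟨fun x => ?_, ?_⟩
    · simp only [condChannel, h, if_false]
      exact div_nonneg (hQ _) (marginalY_nonneg hQ y)
    · simp only [condChannel, h, if_false, ← Finset.sum_div]
      exact div_self h

theorem joint_condChannel {Q : X × Y → ℝ} (hQ : ∀ z, 0 ≤ Q z) :
    joint (marginalY Q) (condChannel Q) = Q := by
  funext ⟨x, y⟩
  simp only [joint, condChannel]
  split_ifs with h
  · rw [h, zero_mul]
    exact le_antisymm (hQ _) (h ▸ le_marginalY hQ x y)
  · field_simp

theorem condEntropy_eq_condChannel {Q : X × Y → ℝ} (hQ : ∀ z, 0 ≤ Q z) :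
    condEntropy Q = -∑ z : X × Y, Q z * Real.log (condChannel Q z.2 z.1) := by
  rw [condEntropy, Fintype.sum_prod_type]
  congr 1
  refine Finset.sum_congr rfl fun x _ => Finset.sum_congr rfl fun y _ => ?_
  simp only [condChannel]
  split_ifs with h
  · rw [le_antisymm (h ▸ le_marginalY hQ x y) (hQ (x, y))]; simp
  · rfl

/-- Under the product of the laws `Q(·|y i)` each sequence of the class has probability exactly
`exp(-n H_Q(X|Y))`, and these add up to at most 1. -/
theorem card_condType_le [Nonempty X] {n : ℕ} (y : Fin n → Y) (Q : X × Y → ℝ)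
    (hQ : ∃ x : Fin n → X, empDist x y = Q) [DecidablePred fun x : Fin n → X => empDist x y = Q] :
    ((Finset.univ.filter fun x : Fin n → X => empDist x y = Q).card : ℝ) ≤
      Real.exp (n * condEntropy Q) := by
  have hQ0 : ∀ z, 0 ≤ Q z := by
    obtain ⟨x₀, rfl⟩ := hQ
    exact empDist_nonneg x₀ y
  have hV := condChannel_mem hQ0
  have h1 : ∑ x : Fin n → X, ∏ i, condChannel Q (y i) (x i) = 1 := by
    rw [sum_prod_apply fun i u => condChannel Q (y i) u]
    exact Finset.prod_eq_one fun i _ => (hV (y i)).2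
  have h2 : ∀ x ∈ Finset.univ.filter (fun x : Fin n → X => empDist x y = Q),
      Real.exp (-(n * condEntropy Q)) = ∏ i, condChannel Q (y i) (x i) := by
    intro x hx
    have hx := (Finset.mem_filter.1 hx).2
    have := prod_apply_eq_exp x y (h := fun z => condChannel Q z.2 z.1) ?_
    · simp only at this
      rw [this, hx, condEntropy_eq_condChannel hQ0]
      congr 1
      ring
    · intro i
      have hp : 0 < Q (x i, y i) := hx ▸ empDist_apply_pos x y i
      have hm := hp.trans_le (le_marginalY hQ0 _ _)
      simp only [condChannel, hm.ne', if_false]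
      positivity
  have h3 : ((Finset.univ.filter fun x : Fin n → X => empDist x y = Q).card : ℝ) *
      Real.exp (-(n * condEntropy Q)) ≤ 1 := by
    rw [← h1, ← nsmul_eq_mul, ← Finset.sum_const, Finset.sum_congr rfl h2]
    exact Finset.sum_le_univ_sum_of_nonneg fun x =>
      Finset.prod_nonneg fun i _ => (hV (y i)).1 _
  rw [Real.exp_neg, ← div_eq_mul_inv, div_le_one (Real.exp_pos _)] at h3
  exact h3

theorem sourceProb_eq_of_support {n : ℕ} {P : X × Y → ℝ} (hP : ∀ z, 0 ≤ P z) (x : Fin n → X)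
    (y : Fin n → Y) (h : ∀ z, P z = 0 → empDist x y z = 0) :
    sourceProb P x y = Real.exp (-(n * ∑ z, empDist x y z * Real.log (empDist x y z / P z))) *
      ∏ i, empDist x y (x i, y i) := by
  have hpos : ∀ i, 0 < P (x i, y i) := fun i =>
    (hP _).lt_of_ne' fun h0 => (empDist_apply_pos x y i).ne' (h _ h0)
  rw [sourceProb, prod_apply_eq_exp x y hpos, prod_apply_eq_exp x y (empDist_apply_pos x y),
    ← Real.exp_add, ← mul_neg, ← mul_add, ← Finset.sum_neg_distrib, ← Finset.sum_add_distrib]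
  congr 2
  refine Finset.sum_congr rfl fun z _ => ?_
  by_cases h0 : empDist x y z = 0
  · simp [h0]
  · rw [Real.log_div h0 fun h' => h0 (h z h')]; ring

theorem sourceProb_eq_zero {n : ℕ} {P : X × Y → ℝ} {x : Fin n → X}
    {y : Fin n → Y} (h : ¬ ∀ z, P z = 0 → empDist x y z = 0) : sourceProb P x y = 0 := by
  push Not at h
  obtain ⟨z, hz, hne⟩ := h
  obtain ⟨i, rfl⟩ := exists_of_empDist_ne_zero hne
  exact Finset.prod_eq_zero (Finset.mem_univ i) hz

theorem exp_le_card_msg (R : ℝ) (n : ℕ) : Real.exp (n * R) ≤ Fintype.card (Msg R n) := by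
  rw [Fintype.card_fin]
  exact_mod_cast (Nat.lt_floor_add_one _).le

theorem card_msg_le {R : ℝ} (hR : 0 ≤ R) (n : ℕ) :
    (Fintype.card (Msg R n) : ℝ) ≤ 2 * Real.exp (n * R) := by
  rw [Fintype.card_fin]
  push_cast
  have := Nat.floor_le (Real.exp_pos (n * R)).le
  have := Real.one_le_exp (x := n * R) (by positivity)
  linarith

theorem innerExponent_nonneg [Nonempty X] {a : (X × Y → ℝ) → ℝ}
    (ha : ContinuousOn a (stdSimplex ℝ (X × Y))) (Rw : ℝ) {Q₀ : X × Y → ℝ}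
    (hQ₀ : Q₀ ∈ stdSimplex ℝ (X × Y)) : 0 ≤ innerExponent a Rw Q₀ := by
  obtain ⟨V, _, h⟩ := (isLeast_innerValues ha Rw hQ₀).1
  rw [← h]
  exact posPart_nonneg _

theorem binMean_binError_le_exp [Nonempty X] {a : (X × Y → ℝ) → ℝ}
    (ha : ContinuousOn a (stdSimplex ℝ (X × Y))) (Rw : ℝ) {n : ℕ} (hn : 0 < n) (x : Fin n → X)
    (y : Fin n → Y) :
    binMean (fun f : (Fin n → X) → Msg Rw n =>
        binError (fun x' => Real.exp (n * a (empDist x' y))) x f) ≤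
      (jointTypes X Y n).card * Real.exp (-(n * innerExponent a Rw (empDist x y))) := by
  classical
  set E := innerExponent a Rw (empDist x y) with hE
  have hQ₀ := empDist_mem_stdSimplex hn x y
  have hs : ∀ x' : Fin n → X, 0 < Real.exp (n * a (empDist x' y)) := fun _ => Real.exp_pos _
  have hE0 : 0 ≤ E := innerExponent_nonneg ha Rw hQ₀
  -- If `E = 0`, the trivial bound 1 suffices. If `E > 0`, the outer truncation is inactive and `E`
  -- lies below the untruncated expression for every `Q`.
  rcases hE0.eq_or_lt with h0 | h0
  · refine (binMean_binError_le_one hs x).trans ?_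
    rw [← h0]
    simp only [mul_zero, neg_zero, Real.exp_zero, mul_one]
    exact_mod_cast Finset.card_pos.2 ⟨_, empDist_mem_jointTypes x y⟩
  refine (binMean_binError_le_sum hs x).trans ?_
  rw [← Finset.sum_fiberwise_of_maps_to (s := Finset.univ) (t := jointTypes X Y n)
    (g := fun x' => empDist x' y) fun x' _ => empDist_mem_jointTypes x' y]
  refine (Finset.sum_le_card_nsmul _ _ (Real.exp (-(n * E))) fun Q _ => ?_).trans
    (by rw [nsmul_eq_mul])
  rcases (Finset.univ.filter fun x' : Fin n → X => empDist x' y = Q).eq_empty_or_nonempty with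
    hemp | ⟨x₁, hx₁⟩
  · rw [hemp, Finset.sum_empty]; positivity
  have hQ := (Finset.mem_filter.1 hx₁).2
  have hQs : Q ∈ stdSimplex ℝ (X × Y) := hQ ▸ empDist_mem_stdSimplex hn x₁ y
  have hcount := card_condType_le y Q ⟨x₁, hQ⟩
  have hjoint : joint (marginalY (empDist x y)) (condChannel Q) = Q := by
    rw [marginalY_empDist x x₁ y, hQ, joint_condChannel hQs.1]
  have hle := innerExponent_le ha Rw hQ₀ (condChannel_mem hQs.1)
  rw [innerObjective, hjoint, ← hE] at hle
  have ht : E ≤ Rw - condEntropy Q + posPart (a (empDist x y) - a Q) := by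
    rcases le_max_iff.1 hle with h | h
    · linarith
    · exact h
  have hterm : ∀ x' ∈ Finset.univ.filter (fun x' : Fin n → X => empDist x' y = Q),
      1 / (Fintype.card (Msg Rw n) : ℝ) *
        min 1 (Real.exp (n * a (empDist x' y)) / Real.exp (n * a (empDist x y))) ≤
      Real.exp (-(n * Rw)) * Real.exp (-(n * posPart (a (empDist x y) - a Q))) := by
    intro x' hx'
    rw [(Finset.mem_filter.1 hx').2]
    refine mul_le_mul ?_ ?_ (by positivity) (by positivity)
    · rw [Real.exp_neg, ← one_div]
      exact one_div_le_one_div_of_le (Real.exp_pos _) (exp_le_card_msg Rw n)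
    · rcases le_total (a (empDist x y) - a Q) 0 with h | h
      · rw [posPart, max_eq_left h]
        simp
      · rw [posPart, max_eq_right h, ← Real.exp_sub]
        exact (min_le_right _ _).trans (le_of_eq (by ring_nf))
  refine (Finset.sum_le_sum hterm).trans ?_
  rw [Finset.sum_const, nsmul_eq_mul]
  calc _ ≤ Real.exp (n * condEntropy Q) *
        (Real.exp (-(n * Rw)) * Real.exp (-(n * posPart (a (empDist x y) - a Q)))) := by gcongr
    _ = Real.exp (-(n * (Rw - condEntropy Q + posPart (a (empDist x y) - a Q)))) := by
        rw [← Real.exp_add, ← Real.exp_add]; ring_nf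
    _ ≤ _ := by gcongr

/-- On the class of one type `Q` the summand is the product probability `Q^n`, so each class
contributes at most 1. -/
theorem sum_prod_empDist_le {n : ℕ} (hn : 0 < n) :
    ∑ x : Fin n → X, ∑ y : Fin n → Y, ∏ i, empDist x y (x i, y i) ≤
      ((jointTypes X Y n).card : ℝ) := by
  classical
  rw [← Fintype.sum_prod_type' (f := fun (x : Fin n → X) (y : Fin n → Y) =>
    ∏ i, empDist x y (x i, y i)),
    ← Finset.sum_fiberwise_of_maps_to (s := Finset.univ) (t := jointTypes X Y n)
    (g := fun p : (Fin n → X) × (Fin n → Y) => empDist p.1 p.2)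
    fun p _ => empDist_mem_jointTypes p.1 p.2]
  refine (Finset.sum_le_card_nsmul _ _ 1 fun Q _ => ?_).trans (by simp)
  rcases (Finset.univ.filter fun p : (Fin n → X) × (Fin n → Y) =>
    empDist p.1 p.2 = Q).eq_empty_or_nonempty with hemp | ⟨p₁, hp₁⟩
  · rw [hemp, Finset.sum_empty]; norm_num
  have hQs : Q ∈ stdSimplex ℝ (X × Y) :=
    (Finset.mem_filter.1 hp₁).2 ▸ empDist_mem_stdSimplex hn p₁.1 p₁.2
  have h1 : ∑ p : (Fin n → X) × (Fin n → Y), ∏ i, Q (p.1 i, p.2 i) = 1 := by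
    rw [Fintype.sum_prod_type, sum_sum_prod_apply fun _ => Q]
    simp [hQs.2]
  rw [← h1]
  refine (le_of_eq (Finset.sum_congr rfl fun p hp => ?_)).trans
    (Finset.sum_le_univ_sum_of_nonneg fun p => Finset.prod_nonneg fun i _ => hQs.1 _)
  rw [(Finset.mem_filter.1 hp).2]

theorem sourceProb_nonneg {n : ℕ} {P : X × Y → ℝ} (hP : ∀ z, 0 ≤ P z) (x : Fin n → X)
    (y : Fin n → Y) : 0 ≤ sourceProb P x y :=
  Finset.prod_nonneg fun _ _ => hP _

/-- The number of types enters twice: once for the types of the competitors, once for those of the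
source pair. -/
theorem avgFalseReject_le [Nonempty X] {P : X × Y → ℝ} (hP : ∀ z, 0 ≤ P z)
    {a : (X × Y → ℝ) → ℝ} (ha : ContinuousOn a (stdSimplex ℝ (X × Y))) {Rw E : ℝ}
    (hE : ∀ Q ∈ stdSimplex ℝ (X × Y), (∀ z, P z = 0 → Q z = 0) →
      E ≤ ∑ z, Q z * Real.log (Q z / P z) + innerExponent a Rw Q)
    (Rs : ℝ) {n : ℕ} (hn : 0 < n) :
    avgFalseReject P a Rw Rs n ≤
      ((n + 1 : ℝ) ^ Fintype.card (X × Y)) ^ 2 * Real.exp (-(n * E)) := by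
  set c : ℝ := ((jointTypes X Y n).card : ℝ) with hc
  have hc0 : 0 ≤ c := Nat.cast_nonneg _
  have hcn : c ≤ (n + 1 : ℝ) ^ Fintype.card (X × Y) := by
    rw [hc]
    exact_mod_cast card_jointTypes_le (X := X) (Y := Y) n
  have hK : 0 ≤ 1 / (Fintype.card (Msg Rs n) : ℝ) := by positivity
  have hterm : ∀ (x : Fin n → X) (y : Fin n → Y), sourceProb P x y *
      binMean (fun f : (Fin n → X) → Msg Rw n =>
        binError (fun x' => Real.exp (n * a (empDist x' y))) x f) ≤
      c * Real.exp (-(n * E)) * ∏ i, empDist x y (x i, y i) := by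
    intro x y
    have hprod : 0 ≤ ∏ i, empDist x y (x i, y i) :=
      Finset.prod_nonneg fun i _ => empDist_nonneg _ _ _
    by_cases h : ∀ z, P z = 0 → empDist x y z = 0
    · refine (mul_le_mul_of_nonneg_left (binMean_binError_le_exp ha Rw hn x y)
        (sourceProb_nonneg hP x y)).trans ?_
      rw [sourceProb_eq_of_support hP x y h, ← hc]
      set D := ∑ z, empDist x y z * Real.log (empDist x y z / P z)
      have hle := hE _ (empDist_mem_stdSimplex hn x y) h
      calc _ = c * Real.exp (-(n * (D + innerExponent a Rw (empDist x y)))) *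
            ∏ i, empDist x y (x i, y i) := by
            rw [mul_add, neg_add, Real.exp_add]; ring
        _ ≤ _ := by gcongr
    · rw [sourceProb_eq_zero h, zero_mul]
      positivity
  have hnn : 0 ≤ ∑ x : Fin n → X, ∑ y : Fin n → Y, sourceProb P x y *
      binMean (fun f : (Fin n → X) → Msg Rw n =>
        binError (fun x' => Real.exp (n * a (empDist x' y))) x f) := by
    refine Finset.sum_nonneg fun x _ => Finset.sum_nonneg fun y _ =>
      mul_nonneg (sourceProb_nonneg hP x y) (Finset.sum_nonneg fun f _ => ?_)
    exact mul_nonneg (by positivity) (binError_nonneg (fun _ => Real.exp_pos _) x f)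
  rw [avgFalseReject_eq]
  calc _ ≤ 1 * ∑ x : Fin n → X, ∑ y : Fin n → Y, sourceProb P x y *
      binMean (fun f : (Fin n → X) → Msg Rw n =>
        binError (fun x' => Real.exp (n * a (empDist x' y))) x f) := by
        gcongr; linarith
    _ ≤ ∑ x : Fin n → X, ∑ y : Fin n → Y, c * Real.exp (-(n * E)) *
        ∏ i, empDist x y (x i, y i) := by
        rw [one_mul]
        exact Finset.sum_le_sum fun x _ => Finset.sum_le_sum fun y _ => hterm x y
    _ = c * Real.exp (-(n * E)) * ∑ x : Fin n → X, ∑ y : Fin n → Y,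
        ∏ i, empDist x y (x i, y i) := by simp only [Finset.mul_sum]
    _ ≤ c * Real.exp (-(n * E)) * c := by
        gcongr
        exact sum_prod_empDist_le hn
    _ = c ^ 2 * Real.exp (-(n * E)) := by ring
    _ ≤ _ := by gcongr

end Types

/-! ### Second-moment concentration for independent coordinates -/

section Concentration

variable {n : ℕ} {Z : Type*} [Fintype Z] [DecidableEq Z]

theorem sum_prod_eq_one {μ : Fin n → Z → ℝ} (hμ : ∀ i, μ i ∈ stdSimplex ℝ Z) :
    ∑ ξ : Fin n → Z, ∏ i, μ i (ξ i) = 1 := by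
  rw [sum_prod_apply]
  exact Finset.prod_eq_one fun i _ => (hμ i).2

theorem sum_prod_mul_mul_eq_zero (μ h : Fin n → Z → ℝ) {j k : Fin n} (hjk : j ≠ k)
    (h0 : ∑ z, μ j z * h j z = 0) :
    ∑ ξ : Fin n → Z, (∏ i, μ i (ξ i)) * (h j (ξ j) * h k (ξ k)) = 0 := by
  have h1 : ∀ ξ : Fin n → Z, (∏ i, μ i (ξ i)) * (h j (ξ j) * h k (ξ k)) =
      ∏ i, μ i (ξ i) * ((if i = j then h i (ξ i) else 1) * if i = k then h i (ξ i) else 1) := by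
    intro ξ
    rw [Finset.prod_mul_distrib, Finset.prod_mul_distrib]
    simp
  simp only [h1]
  rw [sum_prod_apply fun i z =>
    μ i z * ((if i = j then h i z else 1) * if i = k then h i z else 1)]
  refine Finset.prod_eq_zero (Finset.mem_univ j) ?_
  simpa [hjk] using h0

/-- The variance of a sum of independent centred variables bounded by one. -/
theorem sum_prod_mul_sq_le {μ h : Fin n → Z → ℝ} (hμ : ∀ i, μ i ∈ stdSimplex ℝ Z)
    (h0 : ∀ i, ∑ z, μ i z * h i z = 0) (hb : ∀ i z, |h i z| ≤ 1) :
    ∑ ξ : Fin n → Z, (∏ i, μ i (ξ i)) * (∑ j, h j (ξ j)) ^ 2 ≤ n := by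
  simp only [sq, Finset.sum_mul_sum]
  simp only [Finset.mul_sum]
  rw [Finset.sum_comm]
  refine (Finset.sum_le_card_nsmul _ _ 1 fun j _ => ?_).trans (by simp)
  rw [Finset.sum_comm, Finset.sum_eq_single j]
  · rw [← sum_prod_eq_one hμ]
    refine Finset.sum_le_sum fun ξ _ => mul_le_of_le_one_right
      (Finset.prod_nonneg fun i _ => (hμ i).1 _) ?_
    rw [← abs_mul_abs_self]
    exact mul_le_one₀ (hb _ _) (abs_nonneg _) (hb _ _)
  · intro k _ hk
    exact sum_prod_mul_mul_eq_zero μ h hk.symm (h0 j)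
  · simp

/-- Chebyshev's inequality for finitely many such sums at once. -/
theorem one_sub_le_sum_typical {κ : Type*} [Fintype κ] {μ : Fin n → Z → ℝ}
    {h : κ → Fin n → Z → ℝ} (hμ : ∀ i, μ i ∈ stdSimplex ℝ Z)
    (h0 : ∀ l i, ∑ z, μ i z * h l i z = 0) (hb : ∀ l i z, |h l i z| ≤ 1) (hn : 0 < n) {δ : ℝ}
    (hδ : 0 < δ) [DecidablePred fun ξ : Fin n → Z => ∀ l, |∑ j, h l j (ξ j)| ≤ n * δ] :
    1 - Fintype.card κ / (n * δ ^ 2) ≤ ∑ ξ : Fin n → Z, (∏ i, μ i (ξ i)) *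
      (if ∀ l, |∑ j, h l j (ξ j)| ≤ n * δ then 1 else 0) := by
  have hnδ : (0 : ℝ) < n * δ := by positivity
  -- Pointwise Markov and union bound: if some sum exceeds `nδ`, its normalised square is at least 1
  -- and the left side is nonpositive.
  have hle : ∀ ξ : Fin n → Z, (∏ i, μ i (ξ i)) -
      ∑ l, (∏ i, μ i (ξ i)) * (∑ j, h l j (ξ j)) ^ 2 / (n * δ) ^ 2 ≤ (∏ i, μ i (ξ i)) *
      (if ∀ l, |∑ j, h l j (ξ j)| ≤ n * δ then 1 else 0) := by
    intro ξ
    have hp : 0 ≤ ∏ i, μ i (ξ i) := Finset.prod_nonneg fun i _ => (hμ i).1 _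
    have hnn : ∀ l ∈ Finset.univ, 0 ≤
        (∏ i, μ i (ξ i)) * (∑ j, h l j (ξ j)) ^ 2 / (n * δ) ^ 2 := fun l _ => by positivity
    split_ifs with hc
    · have := Finset.sum_nonneg hnn
      linarith
    · push Not at hc
      obtain ⟨l, hl⟩ := hc
      have h1 := Finset.single_le_sum hnn (Finset.mem_univ l)
      have h2 : 1 ≤ (∑ j, h l j (ξ j)) ^ 2 / (n * δ) ^ 2 := by
        rw [one_le_div (by positivity), ← sq_abs (∑ j, h l j (ξ j))]
        gcongr
      have h3 : ∏ i, μ i (ξ i) ≤ (∏ i, μ i (ξ i)) * (∑ j, h l j (ξ j)) ^ 2 / (n * δ) ^ 2 := by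
        rw [mul_div_assoc]
        exact le_mul_of_one_le_right hp h2
      linarith
  refine le_trans ?_ (Finset.sum_le_sum fun ξ _ => hle ξ)
  rw [Finset.sum_sub_distrib, sum_prod_eq_one hμ, Finset.sum_comm]
  refine sub_le_sub_left ?_ _
  refine (Finset.sum_le_card_nsmul _ _ (n / (n * δ) ^ 2) fun l _ => ?_).trans (le_of_eq ?_)
  · rw [← Finset.sum_div]
    gcongr
    exact sum_prod_mul_sq_le hμ (h0 l) (hb l)
  · rw [Finset.card_univ, nsmul_eq_mul]
    field_simp

end Concentration

/-! ### Typical sets, change of measure and counting competitors -/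

section Typical

variable {X Y : Type*} [Fintype X] [DecidableEq X] [Fintype Y] [DecidableEq Y]

theorem abs_indicator_sub_le_one (p : Prop) [Decidable p] {t : ℝ} (h0 : 0 ≤ t) (h1 : t ≤ 1) :
    |(if p then (1 : ℝ) else 0) - t| ≤ 1 := by
  rw [abs_le]
  split_ifs <;> constructor <;> linarith

theorem sum_indicator_eq_empDist {n : ℕ} (x : Fin n → X) (y : Fin n → Y) (z : X × Y) :
    ∑ i, (if (x i, y i) = z then (1 : ℝ) else 0) = n * empDist x y z := by
  rw [sum_apply_eq_empDist x y fun w => if w = z then (1 : ℝ) else 0]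
  simp

theorem abs_natCast_mul_le_iff {n : ℕ} (hn : 0 < n) (t δ : ℝ) :
    |(n : ℝ) * t| ≤ n * δ ↔ |t| ≤ δ := by
  have : (0 : ℝ) < n := by positivity
  rw [abs_mul, abs_of_pos this, mul_le_mul_iff_of_pos_left this]

theorem le_one_of_mem_stdSimplex {Z : Type*} [Fintype Z] {Q : Z → ℝ} (hQ : Q ∈ stdSimplex ℝ Z)
    (z : Z) : Q z ≤ 1 :=
  hQ.2 ▸ Finset.single_le_sum (fun z _ => hQ.1 z) (Finset.mem_univ z)

open Classical in
theorem one_sub_le_sum_jointTypical {n : ℕ} (hn : 0 < n) {Q : X × Y → ℝ}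
    (hQ : Q ∈ stdSimplex ℝ (X × Y)) {δ : ℝ} (hδ : 0 < δ) :
    1 - Fintype.card (X × Y) / (n * δ ^ 2) ≤ ∑ x : Fin n → X, ∑ y : Fin n → Y,
      (∏ i, Q (x i, y i)) * (if ∀ z, |empDist x y z - Q z| ≤ δ then 1 else 0) := by
  refine (one_sub_le_sum_typical (n := n) (μ := fun _ => Q)
    (h := fun (z : X × Y) _ w => (if w = z then (1 : ℝ) else 0) - Q z) (fun _ => hQ) (fun z _ => ?_)
    (fun z _ w => abs_indicator_sub_le_one _ (hQ.1 z) (le_one_of_mem_stdSimplex hQ z))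
    hn hδ).trans (le_of_eq ?_)
  · simp [mul_sub, ← Finset.sum_mul, hQ.2]
  · rw [← Fintype.sum_prod_type' (f := fun (x : Fin n → X) (y : Fin n → Y) =>
      (∏ i, Q (x i, y i)) * (if ∀ z, |empDist x y z - Q z| ≤ δ then (1 : ℝ) else 0))]
    refine Fintype.sum_equiv (Equiv.arrowProdEquivProdArrow _ _ _) _ _ fun ξ => ?_
    congr 1
    have : ∀ z, ∑ j, ((if ξ j = z then (1 : ℝ) else 0) - Q z) =
        n * (empDist (fun i => (ξ i).1) (fun i => (ξ i).2) z - Q z) := by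
      intro z
      rw [Finset.sum_sub_distrib, mul_sub,
        ← sum_indicator_eq_empDist (fun i => (ξ i).1) (fun i => (ξ i).2)]
      simp
    simp only [this, abs_natCast_mul_le_iff hn]
    rfl

open Classical in
-- Given `y`, the coordinates of `x'` are independent with laws `V (y i)`. The indicator of the pair
-- `z` at place `i` has mean `V (y i) z.1` if `y i = z.2` and 0 otherwise; these means add up to `n`
-- times the joint distribution.
theorem one_sub_le_sum_condTypical {n : ℕ} (hn : 0 < n) {V : Y → X → ℝ}
    (hV : V ∈ channels X Y) (x : Fin n → X) (y : Fin n → Y) {δ : ℝ} (hδ : 0 < δ) :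
    1 - Fintype.card (X × Y) / (n * δ ^ 2) ≤ ∑ x' : Fin n → X, (∏ i, V (y i) (x' i)) *
      (if ∀ z, |empDist x' y z - joint (marginalY (empDist x y)) V z| ≤ δ then 1 else 0) := by
  refine (one_sub_le_sum_typical (n := n) (μ := fun i => V (y i))
    (h := fun (z : X × Y) i u => (if (u, y i) = z then (1 : ℝ) else 0) -
      if y i = z.2 then V (y i) z.1 else 0) (fun i => hV _) (fun z i => ?_)
    (fun z i u => abs_indicator_sub_le_one _ ?_ ?_) hn hδ).trans (le_of_eq ?_)
  · obtain ⟨z1, z2⟩ := z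
    by_cases h : y i = z2
    · simp [h, mul_sub, ← Finset.sum_mul, (hV _).2]
    · simp [h]
  · split_ifs <;> [exact (hV _).1 _; exact le_rfl]
  · split_ifs <;> [exact le_one_of_mem_stdSimplex (hV _) _; exact zero_le_one]
  · refine Finset.sum_congr rfl fun x' _ => ?_
    congr 1
    have : ∀ z : X × Y, ∑ j, ((if (x' j, y j) = z then (1 : ℝ) else 0) -
        if y j = z.2 then V (y j) z.1 else 0) =
        n * (empDist x' y z - joint (marginalY (empDist x y)) V z) := by
      intro z
      rw [Finset.sum_sub_distrib, mul_sub, sum_indicator_eq_empDist,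
        sum_apply_eq_empDist x y fun w => if w.2 = z.2 then V w.2 z.1 else 0]
      congr 2
      rw [Fintype.sum_prod_type]
      simp [joint, marginalY, Finset.sum_mul]
    simp only [this, abs_natCast_mul_le_iff hn]

theorem exists_forall_abs_sub_le {Z : Type*} [Fintype Z] {F : (Z → ℝ) → ℝ}
    (hF : ContinuousOn F (stdSimplex ℝ Z)) {Q : Z → ℝ} (hQ : Q ∈ stdSimplex ℝ Z) {ε : ℝ}
    (hε : 0 < ε) :
    ∃ δ > 0, ∀ Q' ∈ stdSimplex ℝ Z, (∀ z, |Q' z - Q z| ≤ δ) → |F Q' - F Q| ≤ ε := by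
  obtain ⟨δ, hδ, h⟩ := Metric.continuousOn_iff.1 hF Q hQ ε hε
  refine ⟨δ / 2, by positivity, fun Q' hQ' hd => (h Q' hQ' ?_).le⟩
  refine lt_of_le_of_lt ((dist_pi_le_iff (by positivity)).2 hd) (by linarith)

/-- With `V` fixed inside the logarithm the entropy becomes linear in the joint distribution, hence
stable under small deviations of the type. -/
theorem condEntropy_joint (q : Y → ℝ) {V : Y → X → ℝ} (hV : V ∈ channels X Y) :
    condEntropy (joint q V) = -∑ z, joint q V z * Real.log (V z.2 z.1) := by
  rw [condEntropy, Fintype.sum_prod_type]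
  congr 1
  refine Finset.sum_congr rfl fun x _ => Finset.sum_congr rfl fun y _ => ?_
  rw [marginalY_joint q hV]
  by_cases h : q y = 0
  · simp [joint, h]
  · simp only [joint]
    rw [mul_div_cancel_left₀ _ h]

theorem abs_joint_sub_le {Q Q' : X × Y → ℝ} {V : Y → X → ℝ} (hV : V ∈ channels X Y) {δ : ℝ}
    (h : ∀ z, |Q' z - Q z| ≤ δ) (z : X × Y) :
    |joint (marginalY Q') V z - joint (marginalY Q) V z| ≤ Fintype.card X * δ := by
  have hV0 := (hV z.2).1 z.1
  have hV1 := le_one_of_mem_stdSimplex (hV z.2) z.1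
  rw [joint, joint, ← sub_mul, abs_mul, abs_of_nonneg hV0]
  refine (mul_le_of_le_one_right (abs_nonneg _) hV1).trans ?_
  rw [marginalY, marginalY, ← Finset.sum_sub_distrib]
  refine (Finset.abs_sum_le_sum_abs _ _).trans ?_
  refine (Finset.sum_le_card_nsmul _ _ δ fun u _ => h _).trans ?_
  rw [Finset.card_univ, nsmul_eq_mul]

/-- Change of measure: the log-likelihood ratio of `Q` to `P` is `n` times a linear function of the
joint type. Pairs of zero `Q`-probability are trivial. -/
theorem sourceProb_ge_of_support {n : ℕ} {P Q : X × Y → ℝ} (hP : ∀ z, 0 ≤ P z)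
    (hQ : ∀ z, 0 ≤ Q z) (hQP : ∀ z, P z = 0 → Q z = 0) {x : Fin n → X} {y : Fin n → Y} {D : ℝ}
    (hD : ∑ z, empDist x y z * Real.log (Q z / P z) ≤ D) :
    Real.exp (-(n * D)) * ∏ i, Q (x i, y i) ≤ sourceProb P x y := by
  by_cases h : ∀ i, Q (x i, y i) ≠ 0
  · have hQpos : ∀ i, 0 < Q (x i, y i) := fun i => (hQ _).lt_of_ne' (h i)
    have hPpos : ∀ i, 0 < P (x i, y i) := fun i => (hP _).lt_of_ne' fun h0 => h i (hQP _ h0)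
    rw [sourceProb, prod_apply_eq_exp x y hQpos, prod_apply_eq_exp x y hPpos, ← Real.exp_add]
    refine Real.exp_le_exp.2 ?_
    have : ∑ z, empDist x y z * Real.log (P z) = ∑ z, empDist x y z * Real.log (Q z) -
        ∑ z, empDist x y z * Real.log (Q z / P z) := by
      rw [← Finset.sum_sub_distrib]
      refine Finset.sum_congr rfl fun z _ => ?_
      by_cases h0 : empDist x y z = 0
      · simp [h0]
      · obtain ⟨i, rfl⟩ := exists_of_empDist_ne_zero h0
        rw [Real.log_div (hQpos i).ne' (hPpos i).ne']; ring
    rw [this, mul_sub]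
    have := mul_le_mul_of_nonneg_left hD (Nat.cast_nonneg (α := ℝ) n)
    linarith
  · push Not at h
    obtain ⟨i, hi⟩ := h
    rw [Finset.prod_eq_zero (Finset.mem_univ i) hi, mul_zero]
    exact sourceProb_nonneg hP x y

open Classical in
/-- A lower bound on the number of sequences, other than `x`, that are conditionally typical. -/
theorem exp_le_card_condTypical {n : ℕ} (hn : 0 < n) {V : Y → X → ℝ} (hV : V ∈ channels X Y)
    (hVpos : ∀ y x, 0 < V y x) {v : ℝ} (hv : ∀ y x, V y x ≤ v) (x : Fin n → X) (y : Fin n → Y)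
    {δ : ℝ} (hδ : 0 < δ) (hlarge : Fintype.card (X × Y) / (n * δ ^ 2) + v ^ n ≤ 1 / 2) {H : ℝ}
    (hH : ∀ x' : Fin n → X,
      (∀ z, |empDist x' y z - joint (marginalY (empDist x y)) V z| ≤ δ) →
      ∑ z, empDist x' y z * Real.log (V z.2 z.1) ≤ -H) :
    1 / 2 * Real.exp (n * H) ≤ (Finset.univ.filter fun x' : Fin n → X => x' ≠ x ∧
      ∀ z, |empDist x' y z - joint (marginalY (empDist x y)) V z| ≤ δ).card := by
  set T := Finset.univ.filter fun x' : Fin n → X => x' ≠ x ∧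
      ∀ z, |empDist x' y z - joint (marginalY (empDist x y)) V z| ≤ δ with hT
  have hprod : ∀ x' : Fin n → X, 0 ≤ ∏ i, V (y i) (x' i) :=
    fun x' => Finset.prod_nonneg fun i _ => (hVpos _ _).le
  -- The true `x` is not a competitor; removing it costs at most `v ^ n` of probability.
  have hx : ∏ i, V (y i) (x i) ≤ v ^ n := by
    refine (Finset.prod_le_prod (fun i _ => (hVpos _ _).le) fun i _ => hv (y i) (x i)).trans
      (le_of_eq ?_)
    simp
  have h1 := one_sub_le_sum_condTypical hn hV x y hδ
  rw [← Finset.add_sum_erase _ _ (Finset.mem_univ x)] at h1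
  have h2 : (∏ i, V (y i) (x i)) *
      (if ∀ z, |empDist x y z - joint (marginalY (empDist x y)) V z| ≤ δ then 1 else 0) ≤ v ^ n :=
    (mul_le_of_le_one_right (hprod x) (by split_ifs <;> norm_num)).trans hx
  have h3 : ∑ x' ∈ Finset.univ.erase x, (∏ i, V (y i) (x' i)) *
      (if ∀ z, |empDist x' y z - joint (marginalY (empDist x y)) V z| ≤ δ then (1 : ℝ) else 0) =
      ∑ x' ∈ T, ∏ i, V (y i) (x' i) := by
    simp only [mul_ite, mul_one, mul_zero]
    rw [← Finset.sum_filter]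
    refine Finset.sum_congr ?_ fun _ _ => rfl
    ext x'
    simp [hT]
  have h4 : ∑ x' ∈ T, ∏ i, V (y i) (x' i) ≤ T.card * Real.exp (-(n * H)) := by
    rw [← nsmul_eq_mul]
    refine Finset.sum_le_card_nsmul _ _ _ fun x' hx' => ?_
    have := prod_apply_eq_exp x' y (h := fun z => V z.2 z.1) fun i => hVpos _ _
    simp only at this
    rw [this]
    refine Real.exp_le_exp.2 ?_
    rw [← mul_neg]
    exact mul_le_mul_of_nonneg_left (hH x' (Finset.mem_filter.1 hx').2.2) (Nat.cast_nonneg n)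
  have h5 : 1 / 2 ≤ T.card * Real.exp (-(n * H)) := by linarith
  calc 1 / 2 * Real.exp (n * H) ≤ T.card * Real.exp (-(n * H)) * Real.exp (n * H) := by gcongr
    _ = T.card := by rw [mul_assoc, ← Real.exp_add]; simp

/-- The ratio is of constant order when `μ` dominates `c + 1` and about `μ/(c+1)` otherwise; `t`
majorises both exponents, 0 and `R - H + Δ`. -/
theorem exp_le_ratio {μ c t R H Δ : ℝ} (n : ℕ) (hμ : 1 / 4 * Real.exp (n * (H - R)) ≤ μ)
    (hΔ : 0 ≤ Δ) (hc : c ≤ Real.exp (n * Δ)) (hc0 : 0 < c) (ht : R - H + Δ ≤ t) (ht0 : 0 ≤ t) :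
    1 / 9 * Real.exp (-(n * t)) ≤ μ / (c + 1 + μ) := by
  have hμ0 : 0 < μ := lt_of_lt_of_le (by positivity) hμ
  have hn : (0 : ℝ) ≤ n := Nat.cast_nonneg n
  have h1 : 1 ≤ Real.exp (n * Δ) := Real.one_le_exp (by positivity)
  have h2 : 1 ≤ Real.exp (n * t) := Real.one_le_exp (by positivity)
  have h3 : Real.exp (n * Δ) ≤ Real.exp (n * t) * Real.exp (n * (H - R)) := by
    rw [← Real.exp_add]
    refine Real.exp_le_exp.2 ?_
    rw [← mul_add]
    exact mul_le_mul_of_nonneg_left (by linarith) hn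
  -- `9 = 4 + 4 + 1`: `c` and 1 are each at most `exp(nΔ)`, hence at most four times `exp(nt) μ`,
  -- and `μ` is at most once that.
  have h4 : c + 1 + μ ≤ 9 * (Real.exp (n * t) * μ) := by
    have h5 : Real.exp (n * t) * Real.exp (n * (H - R)) ≤ 4 * (Real.exp (n * t) * μ) := by
      nlinarith
    have h6 : μ ≤ Real.exp (n * t) * μ := le_mul_of_one_le_left hμ0.le h2
    linarith
  rw [le_div_iff₀ (by positivity), Real.exp_neg]
  calc _ ≤ 1 / 9 * (Real.exp (n * t))⁻¹ * (9 * (Real.exp (n * t) * μ)) := by gcongr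
    _ = μ := by field_simp

end Typical

/-! ### The lower bound and the limit -/

section Exponent

variable {X Y : Type*} [Fintype X] [DecidableEq X] [Fintype Y] [DecidableEq Y]

/-- Since the alphabet starts at 0, it has two elements even at rate zero, so the key factor `1 -
1/|S|` is at least `1/2`. -/
theorem two_le_card_msg {R : ℝ} (hR : 0 ≤ R) (n : ℕ) : (2 : ℝ) ≤ Fintype.card (Msg R n) := by
  rw [Fintype.card_fin]
  have h : 1 ≤ ⌊Real.exp (n * R)⌋₊ :=
    Nat.le_floor (by exact_mod_cast Real.one_le_exp (x := n * R) (by positivity))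
  have : 2 ≤ ⌊Real.exp (n * R)⌋₊ + 1 := by omega
  exact_mod_cast this

theorem continuous_sum_mul {Z : Type*} [Fintype Z] (c : Z → ℝ) :
    Continuous fun Q : Z → ℝ => ∑ z, Q z * c z := by fun_prop

open Classical in
-- The factor `1/4` combines `1/2` from the keys with `1/2` from the `Q₀`-probability of the typical
-- pairs.
theorem le_avgFalseReject_of_forall {n : ℕ} {P Q₀ : X × Y → ℝ} (hP : ∀ z, 0 ≤ P z)
    (hQ₀ : Q₀ ∈ stdSimplex ℝ (X × Y)) (hQP : ∀ z, P z = 0 → Q₀ z = 0)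
    (a : (X × Y → ℝ) → ℝ) (Rw : ℝ) {Rs : ℝ} (hRs : 0 ≤ Rs) (hn : 0 < n) {δ D B : ℝ} (hδ : 0 < δ)
    (hB0 : 0 ≤ B) (hlarge : Fintype.card (X × Y) / (n * δ ^ 2) ≤ 1 / 2)
    (hD : ∀ (x : Fin n → X) (y : Fin n → Y), (∀ z, |empDist x y z - Q₀ z| ≤ δ) →
      ∑ z, empDist x y z * Real.log (Q₀ z / P z) ≤ D)
    (hB : ∀ (x : Fin n → X) (y : Fin n → Y), (∀ z, |empDist x y z - Q₀ z| ≤ δ) →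
      B ≤ binMean (fun f : (Fin n → X) → Msg Rw n =>
        binError (fun x' => Real.exp (n * a (empDist x' y))) x f)) :
    1 / 4 * (Real.exp (-(n * D)) * B) ≤ avgFalseReject P a Rw Rs n := by
  have h1 : 1 / 2 ≤ ∑ x : Fin n → X, ∑ y : Fin n → Y,
      (∏ i, Q₀ (x i, y i)) * (if ∀ z, |empDist x y z - Q₀ z| ≤ δ then 1 else 0) :=
    le_trans (by linarith) (one_sub_le_sum_jointTypical hn hQ₀ hδ)
  have h2 : ∀ (x : Fin n → X) (y : Fin n → Y), Real.exp (-(n * D)) * B * ((∏ i, Q₀ (x i, y i)) *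
      (if ∀ z, |empDist x y z - Q₀ z| ≤ δ then 1 else 0)) ≤ sourceProb P x y *
      binMean (fun f : (Fin n → X) → Msg Rw n =>
        binError (fun x' => Real.exp (n * a (empDist x' y))) x f) := by
    intro x y
    have hs := sourceProb_nonneg hP x y
    split_ifs with h
    · calc _ = Real.exp (-(n * D)) * (∏ i, Q₀ (x i, y i)) * B := by ring
        _ ≤ sourceProb P x y * B := by
          gcongr
          exact sourceProb_ge_of_support hP hQ₀.1 hQP (hD x y h)
        _ ≤ _ := by
          gcongr
          exact hB x y h
    · rw [mul_zero, mul_zero]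
      refine mul_nonneg hs (Finset.sum_nonneg fun f _ => ?_)
      exact mul_nonneg (by positivity) (binError_nonneg (fun _ => Real.exp_pos _) x f)
  have h3 : 1 / 2 ≤ 1 - 1 / (Fintype.card (Msg Rs n) : ℝ) := by
    have := one_div_le_one_div_of_le (by norm_num) (two_le_card_msg hRs n)
    linarith
  rw [avgFalseReject_eq]
  calc 1 / 4 * (Real.exp (-(n * D)) * B)
      = 1 / 2 * (Real.exp (-(n * D)) * B * (1 / 2)) := by ring
    _ ≤ 1 / 2 * (Real.exp (-(n * D)) * B * ∑ x : Fin n → X, ∑ y : Fin n → Y,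
      (∏ i, Q₀ (x i, y i)) * (if ∀ z, |empDist x y z - Q₀ z| ≤ δ then 1 else 0)) := by gcongr
    _ = 1 / 2 * ∑ x : Fin n → X, ∑ y : Fin n → Y, Real.exp (-(n * D)) * B *
      ((∏ i, Q₀ (x i, y i)) * (if ∀ z, |empDist x y z - Q₀ z| ≤ δ then 1 else 0)) := by
        simp only [Finset.mul_sum]
    _ ≤ 1 / 2 * ∑ x : Fin n → X, ∑ y : Fin n → Y, sourceProb P x y *
      binMean (fun f : (Fin n → X) → Msg Rw n =>
        binError (fun x' => Real.exp (n * a (empDist x' y))) x f) := by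
        refine mul_le_mul_of_nonneg_left ?_ (by norm_num)
        exact Finset.sum_le_sum fun x _ => Finset.sum_le_sum fun y _ => h2 x y
    _ ≤ _ := by
        refine mul_le_mul_of_nonneg_right h3 (Finset.sum_nonneg fun x _ =>
          Finset.sum_nonneg fun y _ => ?_)
        exact mul_nonneg (sourceProb_nonneg hP x y) (Finset.sum_nonneg fun f _ =>
          mul_nonneg (by positivity) (binError_nonneg (fun _ => Real.exp_pos _) x f))

/-- The contribution of a full-support channel `V` to the error probability of a typical pair. -/
theorem le_binMean_binError_of_typical {n : ℕ} (hn : 0 < n) {Q₀ : X × Y → ℝ}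
    {V : Y → X → ℝ} (hV : V ∈ channels X Y) (hVpos : ∀ y x, 0 < V y x) {v : ℝ}
    (hv : ∀ y x, V y x ≤ v) (a : (X × Y → ℝ) → ℝ) {Rw : ℝ} (hRw : 0 ≤ Rw) {δ ε : ℝ} (hδ : 0 < δ)
    (hε : 0 < ε) (hlarge : Fintype.card (X × Y) / (n * δ ^ 2) + v ^ n ≤ 1 / 2)
    (x : Fin n → X) (y : Fin n → Y)
    (ha₀ : a (empDist x y) ≤ a Q₀ + ε)
    (ha₁ : ∀ x' : Fin n → X,
      (∀ z, |empDist x' y z - joint (marginalY (empDist x y)) V z| ≤ δ) →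
      a (joint (marginalY Q₀) V) - ε ≤ a (empDist x' y))
    (hH : ∀ x' : Fin n → X,
      (∀ z, |empDist x' y z - joint (marginalY (empDist x y)) V z| ≤ δ) →
      ∑ z, empDist x' y z * Real.log (V z.2 z.1) ≤
        -(condEntropy (joint (marginalY Q₀) V) - ε)) :
    1 / 9 * Real.exp (-(n * (innerObjective a Rw Q₀ V + 3 * ε))) ≤
      binMean (fun f : (Fin n → X) → Msg Rw n =>
        binError (fun x' => Real.exp (n * a (empDist x' y))) x f) := by
  classical
  set Q := joint (marginalY Q₀) V with hQ
  set T := Finset.univ.filter fun x' : Fin n → X => x' ≠ x ∧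
      ∀ z, |empDist x' y z - joint (marginalY (empDist x y)) V z| ≤ δ with hT
  have hcard := exp_le_card_condTypical hn hV hVpos hv x y hδ hlarge hH
  have hn0 : (0 : ℝ) ≤ n := Nat.cast_nonneg n
  have hM : (0 : ℝ) < Fintype.card (Msg Rw n) :=
    (Real.exp_pos _).trans_le (exp_le_card_msg Rw n)
  refine le_trans ?_ (le_binMean_binError (s := fun x' => Real.exp (n * a (empDist x' y)))
    (fun _ => Real.exp_pos _) (T := T) (x := x) (by simp [hT])
    (s₀ := Real.exp (n * (a Q₀ + ε))) (s₁ := Real.exp (n * (a Q - ε))) (Real.exp_pos _)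
    (Real.exp_le_exp.2 (mul_le_mul_of_nonneg_left ha₀ hn0))
    fun x' hx' => Real.exp_le_exp.2 (mul_le_mul_of_nonneg_left
      (ha₁ x' (Finset.mem_filter.1 hx').2.2) hn0))
  have hp := posPart_nonneg (a Q₀ - a Q)
  have hp' := le_posPart (a Q₀ - a Q)
  -- The total loss `3ε` consists of `ε` in the entropy and `ε` in each of the scores `s₀` and `s₁`.
  refine exp_le_ratio (R := Rw) (H := condEntropy Q - ε) (Δ := posPart (a Q₀ - a Q) + 2 * ε) n
    ?_ (by positivity) ?_ (by positivity) ?_ ?_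
  -- `1/4` is the `1/2` of the typical count divided by the 2 in `card_msg_le`.
  · rw [le_div_iff₀ hM]
    calc _ ≤ 1 / 4 * Real.exp (n * (condEntropy Q - ε - Rw)) * (2 * Real.exp (n * Rw)) := by
          gcongr
          exact card_msg_le hRw n
      _ = 1 / 2 * (Real.exp (n * (condEntropy Q - ε - Rw)) * Real.exp (n * Rw)) := by ring
      _ = 1 / 2 * Real.exp (n * (condEntropy Q - ε)) := by
          rw [← Real.exp_add]; ring_nf
      _ ≤ _ := hcard
  · rw [← Real.exp_sub, ← mul_sub]
    exact Real.exp_le_exp.2 (mul_le_mul_of_nonneg_left (by linarith) hn0)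
  · have := le_posPart (Rw - condEntropy Q + posPart (a Q₀ - a Q))
    rw [innerObjective, ← hQ]
    linarith
  · have := posPart_nonneg (Rw - condEntropy Q + posPart (a Q₀ - a Q))
    rw [innerObjective, ← hQ]
    linarith

/-- A lower bound on the error probability, up to a constant factor, for a full-support channel. -/
theorem eventually_le_avgFalseReject_const {P : X × Y → ℝ} (hP : ∀ z, 0 ≤ P z)
    {a : (X × Y → ℝ) → ℝ} (ha : ContinuousOn a (stdSimplex ℝ (X × Y))) {Rw Rs : ℝ} (hRw : 0 ≤ Rw)
    (hRs : 0 ≤ Rs) {Q₀ : X × Y → ℝ} (hQ₀ : Q₀ ∈ stdSimplex ℝ (X × Y))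
    (hQP : ∀ z, P z = 0 → Q₀ z = 0) {V : Y → X → ℝ} (hV : V ∈ channels X Y)
    (hVpos : ∀ y x, 0 < V y x) {v : ℝ} (hv0 : 0 ≤ v) (hv1 : v < 1) (hv : ∀ y x, V y x ≤ v) {ε : ℝ}
    (hε : 0 < ε) :
    ∀ᶠ n : ℕ in atTop, 1 / 36 * Real.exp (-(n * (∑ z, Q₀ z * Real.log (Q₀ z / P z) +
      innerObjective a Rw Q₀ V + 4 * ε))) ≤ avgFalseReject P a Rw Rs n := by
  set Q := joint (marginalY Q₀) V with hQdef
  have hQ : Q ∈ stdSimplex ℝ (X × Y) := joint_mem_stdSimplex hQ₀ hV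
  obtain ⟨δ₁, hδ₁, h₁⟩ := exists_forall_abs_sub_le ha hQ₀ hε
  obtain ⟨δ₂, hδ₂, h₂⟩ := exists_forall_abs_sub_le
    (continuous_sum_mul fun z => Real.log (Q₀ z / P z)).continuousOn hQ₀ hε
  obtain ⟨δ₃, hδ₃, h₃⟩ := exists_forall_abs_sub_le ha hQ hε
  obtain ⟨δ₄, hδ₄, h₄⟩ := exists_forall_abs_sub_le
    (continuous_sum_mul fun z : X × Y => Real.log (V z.2 z.1)).continuousOn hQ hε
  set k : ℝ := (Fintype.card X : ℝ) with hk
  have hk0 : 0 ≤ k := Nat.cast_nonneg _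
  -- A competitor deviates by `δ` from the channel output for the actual type, which deviates by up
  -- to `kδ` from `Q`; hence the divisor `k + 1`.
  set δ := min (min δ₁ δ₂) (min δ₃ δ₄ / (k + 1)) with hδdef
  have hδ : 0 < δ := by positivity
  have hδ1 : δ ≤ δ₁ := (min_le_left _ _).trans (min_le_left _ _)
  have hδ2 : δ ≤ δ₂ := (min_le_left _ _).trans (min_le_right _ _)
  have hδ34 : (k + 1) * δ ≤ min δ₃ δ₄ := by
    have := min_le_right (min δ₁ δ₂) (min δ₃ δ₄ / (k + 1))
    rwa [← hδdef, le_div_iff₀ (by positivity), mul_comm] at this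
  have hlim : Tendsto (fun n : ℕ => Fintype.card (X × Y) / (n * δ ^ 2) + v ^ n) atTop
      (𝓝 (0 + 0)) := by
    refine Tendsto.add ?_ (tendsto_pow_atTop_nhds_zero_of_lt_one hv0 hv1)
    exact tendsto_const_nhds.div_atTop
      (tendsto_natCast_atTop_atTop.atTop_mul_const (by positivity))
  filter_upwards [hlim.eventually_le_const (u := 1 / 2) (by norm_num), eventually_gt_atTop 0]
    with n hlarge hn
  have hv' : 0 ≤ v ^ n := pow_nonneg hv0 n
  have hclose : ∀ (x : Fin n → X) (y : Fin n → Y), (∀ z, |empDist x y z - Q₀ z| ≤ δ) →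
      ∀ x' : Fin n → X, (∀ z, |empDist x' y z - joint (marginalY (empDist x y)) V z| ≤ δ) →
      ∀ z, |empDist x' y z - Q z| ≤ min δ₃ δ₄ := by
    intro x y h x' h' z
    refine (abs_sub_le _ (joint (marginalY (empDist x y)) V z) _).trans (le_trans ?_ hδ34)
    have := abs_joint_sub_le hV h z
    have := h' z
    linarith
  -- `1/36 = 1/4 · 1/9`, and `4ε` is `ε` from the divergence plus `3ε` from the bin error.
  have hmain := le_avgFalseReject_of_forall (δ := δ)
    (D := ∑ z, Q₀ z * Real.log (Q₀ z / P z) + ε)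
    (B := 1 / 9 * Real.exp (-(n * (innerObjective a Rw Q₀ V + 3 * ε)))) hP hQ₀ hQP a Rw hRs hn hδ
    (by positivity) (by linarith)
    (fun x y h => by
      have := (abs_le.1 (h₂ _ (empDist_mem_stdSimplex hn x y) fun z => (h z).trans hδ2)).2
      linarith)
    (fun x y h => by
      refine le_binMean_binError_of_typical hn hV hVpos hv a hRw hδ hε hlarge x y ?_ ?_ ?_
      · have := (abs_le.1 (h₁ _ (empDist_mem_stdSimplex hn x y) fun z => (h z).trans hδ1)).2
        linarith
      · intro x' hx'
        have := (abs_le.1 (h₃ _ (empDist_mem_stdSimplex hn x' y) fun z =>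
          (hclose x y h x' hx' z).trans (min_le_left _ _))).1
        linarith
      · intro x' hx'
        have := (abs_le.1 (h₄ _ (empDist_mem_stdSimplex hn x' y) fun z =>
          (hclose x y h x' hx' z).trans (min_le_right _ _))).2
        rw [condEntropy_joint _ hV]
        linarith)
  refine le_trans (le_of_eq ?_) hmain
  rw [mul_left_comm (Real.exp _), ← Real.exp_add]
  ring_nf

/-- Any channel can be approximated by full-support channels without increasing the inner
objective by more than `ε`. -/
theorem exists_fullSupport_channel [Nontrivial X] {a : (X × Y → ℝ) → ℝ}
    (ha : ContinuousOn a (stdSimplex ℝ (X × Y))) (Rw : ℝ) {Q₀ : X × Y → ℝ}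
    (hQ₀ : Q₀ ∈ stdSimplex ℝ (X × Y)) {V : Y → X → ℝ} (hV : V ∈ channels X Y) {ε : ℝ}
    (hε : 0 < ε) :
    ∃ V' ∈ channels X Y, (∀ y x, 0 < V' y x) ∧ (∃ v, 0 ≤ v ∧ v < 1 ∧ ∀ y x, V' y x ≤ v) ∧
      innerObjective a Rw Q₀ V' ≤ innerObjective a Rw Q₀ V + ε := by
  set k : ℝ := (Fintype.card X : ℝ) with hk
  have hk2 : 2 ≤ k := by
    have : 2 ≤ Fintype.card X := Fintype.one_lt_card
    rw [hk]
    exact_mod_cast this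
  -- Mixing with the uniform law makes all entries positive; since `k ≥ 2`, they are at most `1 - η
  -- + η/2 < 1`.
  set U : ℝ → Y → X → ℝ := fun η y x => (1 - η) * V y x + η * (1 / k) with hU
  have hUmem : ∀ η, 0 ≤ η → η ≤ 1 → U η ∈ channels X Y := by
    intro η h0 h1 y
    refine ⟨fun x => add_nonneg (mul_nonneg (by linarith) ((hV y).1 x)) (by positivity), ?_⟩
    simp only [hU, Finset.sum_add_distrib, ← Finset.mul_sum, (hV y).2, Finset.sum_const,
      Finset.card_univ, nsmul_eq_mul, ← hk]
    field_simp
    ring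
  have hU0 : U 0 = V := by funext y x; simp [hU]
  have hUc : Continuous U := by fun_prop
  have hc : ContinuousOn (fun η => innerObjective a Rw Q₀ (U η)) (Set.Icc 0 1) :=
    (continuousOn_innerObjective ha Rw).comp (f := fun η => (Q₀, U η))
      (by fun_prop) fun η hη => ⟨hQ₀, hUmem η hη.1 hη.2⟩
  have ht : Tendsto (fun η => innerObjective a Rw Q₀ (U η)) (𝓝[>] 0)
      (𝓝 (innerObjective a Rw Q₀ V)) := by
    have := (hc 0 (by simp)).tendsto
    rw [hU0] at this
    refine this.mono_left ?_
    rw [← nhdsWithin_Ioc_eq_nhdsGT (zero_lt_one' ℝ)]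
    exact nhdsWithin_mono _ Set.Ioc_subset_Icc_self
  obtain ⟨η, hη, hη0, hη1⟩ := ((ht.eventually_le_const (lt_add_of_pos_right _ hε)).and
    (Ioo_mem_nhdsGT (zero_lt_one' ℝ))).exists
  have hk' : 1 / k ≤ 1 / 2 := one_div_le_one_div_of_le (by norm_num) hk2
  refine ⟨U η, hUmem η hη0.le hη1.le, fun y x => ?_, ⟨1 - η / 2, by linarith, by linarith,
    fun y x => ?_⟩, hη⟩
  · exact add_pos_of_nonneg_of_pos (mul_nonneg (by linarith) ((hV y).1 x)) (by positivity)
  · have := le_one_of_mem_stdSimplex (hV y) x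
    simp only [hU]
    nlinarith

theorem eventually_le_avgFalseReject [Nontrivial X] {P : X × Y → ℝ} (hP : ∀ z, 0 ≤ P z)
    {a : (X × Y → ℝ) → ℝ} (ha : ContinuousOn a (stdSimplex ℝ (X × Y))) {Rw Rs : ℝ} (hRw : 0 ≤ Rw)
    (hRs : 0 ≤ Rs) {Q₀ : X × Y → ℝ} (hQ₀ : Q₀ ∈ stdSimplex ℝ (X × Y))
    (hQP : ∀ z, P z = 0 → Q₀ z = 0) {V : Y → X → ℝ} (hV : V ∈ channels X Y) {ε : ℝ}
    (hε : 0 < ε) :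
    ∀ᶠ n : ℕ in atTop, Real.exp (-(n * (∑ z, Q₀ z * Real.log (Q₀ z / P z) +
      innerObjective a Rw Q₀ V + ε))) ≤ avgFalseReject P a Rw Rs n := by
  -- Budget for `ε`: one sixth for passing to `V'`, four sixths for the bound with `V'`, one sixth
  -- to absorb the constant `1/36`.
  obtain ⟨V', hV', hpos, ⟨v, hv0, hv1, hv⟩, hle⟩ :=
    exists_fullSupport_channel ha Rw hQ₀ hV (ε := ε / 6) (by positivity)
  have hlim : Tendsto (fun n : ℕ => Real.exp (n * (ε / 6))) atTop atTop :=
    Real.tendsto_exp_atTop.comp (tendsto_natCast_atTop_atTop.atTop_mul_const (by positivity))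
  filter_upwards [eventually_le_avgFalseReject_const hP ha hRw hRs hQ₀ hQP hV' hpos hv0 hv1 hv
    (ε := ε / 6) (by positivity), hlim.eventually_ge_atTop 36] with n hn h36
  refine le_trans ?_ hn
  set D := ∑ z, Q₀ z * Real.log (Q₀ z / P z)
  have h1 : Real.exp (-(n * (D + innerObjective a Rw Q₀ V + ε))) * Real.exp (n * (ε / 6)) ≤
      Real.exp (-(n * (D + innerObjective a Rw Q₀ V' + 4 * (ε / 6)))) := by
    rw [← Real.exp_add]
    refine Real.exp_le_exp.2 ?_
    have := mul_le_mul_of_nonneg_left hle (Nat.cast_nonneg (α := ℝ) n)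
    linarith
  have h2 := mul_le_mul_of_nonneg_left h36
    (Real.exp_pos (-(n * (D + innerObjective a Rw Q₀ V + ε)))).le
  linarith

theorem eventually_avgFalseReject_le [Nonempty X] {P : X × Y → ℝ} (hP : ∀ z, 0 ≤ P z)
    {a : (X × Y → ℝ) → ℝ} (ha : ContinuousOn a (stdSimplex ℝ (X × Y))) {Rw E : ℝ}
    (hE : ∀ Q ∈ stdSimplex ℝ (X × Y), (∀ z, P z = 0 → Q z = 0) →
      E ≤ ∑ z, Q z * Real.log (Q z / P z) + innerExponent a Rw Q)
    (Rs : ℝ) {ε : ℝ} (hε : 0 < ε) :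
    ∀ᶠ n : ℕ in atTop, avgFalseReject P a Rw Rs n ≤ Real.exp (-(n * (E - ε))) := by
  -- The growth estimate is applied at `n + 1`; the constant `exp(-ε)` turns `exp(ε(n+1))` back into
  -- `exp(εn)`.
  have hlo := (isLittleO_pow_exp_pos_mul_atTop (Fintype.card (X × Y) * 2) hε).bound
    (Real.exp_pos (-ε))
  have htend : Tendsto (fun n : ℕ => (n : ℝ) + 1) atTop atTop :=
    tendsto_atTop_add_const_right _ _ tendsto_natCast_atTop_atTop
  filter_upwards [htend.eventually hlo, eventually_gt_atTop 0] with n hb hn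
  rw [Real.norm_of_nonneg (by positivity), Real.norm_of_nonneg (Real.exp_pos _).le,
    ← Real.exp_add] at hb
  refine (avgFalseReject_le hP ha hE Rs hn).trans ?_
  rw [← pow_mul]
  calc _ ≤ Real.exp (-ε + ε * (n + 1)) * Real.exp (-(n * E)) := by gcongr
    _ = _ := by rw [← Real.exp_add]; ring_nf

theorem tendsto_neg_log_div {p : ℕ → ℝ} {E : ℝ}
    (hlow : ∀ ε > 0, ∀ᶠ n : ℕ in atTop, Real.exp (-(n * (E + ε))) ≤ p n)
    (hup : ∀ ε > 0, ∀ᶠ n : ℕ in atTop, p n ≤ Real.exp (-(n * (E - ε)))) :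
    Tendsto (fun n : ℕ => -(Real.log (p n) / n)) atTop (𝓝 E) := by
  rw [Metric.tendsto_nhds]
  intro ε hε
  filter_upwards [hlow (ε / 2) (by positivity), hup (ε / 2) (by positivity),
    eventually_gt_atTop 0] with n h1 h2 hn
  have hn' : (0 : ℝ) < n := by positivity
  have h0 : 0 < p n := (Real.exp_pos _).trans_le h1
  rw [← Real.le_log_iff_exp_le h0] at h1
  rw [← Real.log_le_iff_le_exp h0] at h2
  have h3 : -(E + ε / 2) ≤ Real.log (p n) / n := by
    rw [le_div_iff₀ hn']; linarith
  have h4 : Real.log (p n) / n ≤ -(E - ε / 2) := by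
    rw [div_le_iff₀ hn']; linarith
  rw [Real.dist_eq, abs_lt]
  constructor <;> linarith

end Exponent

end Biometric

theorem theorem1 {X Y : Type*} [Fintype X] [DecidableEq X] [Nontrivial X]
    [Fintype Y] [DecidableEq Y]
    (P : X × Y → ℝ) (hP : P ∈ stdSimplex ℝ (X × Y))
    (a : (X × Y → ℝ) → ℝ) (ha : ContinuousOn a (stdSimplex ℝ (X × Y)))
    (Rw : ℝ) (hRw : 0 ≤ Rw) :
    (∀ Q₀ ∈ stdSimplex ℝ (X × Y),
      IsLeast (Biometric.innerValues a Rw Q₀) (Biometric.innerExponent a Rw Q₀)) ∧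
    IsLeast (Biometric.outerValues P a Rw) (Biometric.frExponent P a Rw) ∧
    ∀ Rs : ℝ, 0 ≤ Rs →
      (∀ᶠ n : ℕ in atTop, 0 < Biometric.avgFalseReject P a Rw Rs n) ∧
      Tendsto (fun n : ℕ =>
          ((-(Real.log (Biometric.avgFalseReject P a Rw Rs n) / (n : ℝ)) : ℝ) : EReal))
        atTop (𝓝 (Biometric.frExponent P a Rw)) := by
  obtain ⟨Q, hQ, V, hV, hQP, hmin⟩ := Biometric.exists_optimal_pair hP ha Rw
  have hleast := Biometric.isLeast_outerValues ha hQ hV hQP hmin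
  have hfr : Biometric.frExponent P a Rw =
      ((∑ z, Q z * Real.log (Q z / P z) + Biometric.innerObjective a Rw Q V : ℝ) : EReal) :=
    hleast.isGLB.sInf_eq
  refine ⟨fun Q₀ hQ₀ => Biometric.isLeast_innerValues ha Rw hQ₀, hfr ▸ hleast, fun Rs hRs => ?_⟩
  -- The lower bound uses only the optimal pair; the upper bound uses its minimality against every
  -- competing pair.
  have hlow := fun (ε : ℝ) (hε : ε > 0) =>
    Biometric.eventually_le_avgFalseReject hP.1 ha hRw hRs hQ hQP hV hε
  refine ⟨(hlow 1 one_pos).mono fun n hn => (Real.exp_pos _).trans_le hn, ?_⟩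
  rw [hfr]
  refine (continuous_coe_real_ereal.tendsto _).comp (Biometric.tendsto_neg_log_div hlow ?_)
  refine fun ε hε => Biometric.eventually_avgFalseReject_le hP.1 ha (fun Q' hQ' hQ'P => ?_) Rs hε
  obtain ⟨V', hV', h⟩ := (Biometric.isLeast_innerValues ha Rw hQ').1
  rw [← h]
  exact hmin Q' hQ' V' hV' hQ'P
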